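/- Let $k$ be a field of characteristic different from $2$ and $3$ that contains a primitive cube root of unity, let $S\in k[t]$ be a polynomial of degree $6$ without repeated roots in an algebraic closure of $k$, let $C$ be the smooth projective curve of genus $2$ over $k$ with affine equation $u^2=S(t)$, and let $J(C)$ be the group of classes of degree-zero divisors on $C$ (over $k$) modulo principal divisors. Call $y\in k[t]$ minimal if $\deg y\le 3$ and $y^2-S=\alpha x^3$ for some $\alpha\in k^*$ and $x\in k[t]$. (1) If $y\in k[t]$ is minimal, then the rational function $y(t)-u$ on $C$ has divisor $3D$ for some divisor $D$ of degree $0$ on $C$ that is not principal (so $[D]$ is a nonzero $3$-torsion element of $J(C)$). (2) For each nonzero $T\in J(C)$ with $3T=0$ there is exactly one minimal $y\in k[t]$ such that the divisor of $y(t)-u$ is $3D$ for a divisor $D$ of degree $0$ on $C$ with class $[D]=T$. -/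

import Mathlib

open Polynomial

noncomputable section

/-! ### Divisors and divisor classes of a function field -/

/-- A point of the complete regular curve with function field `K` over `k`: a discrete valuation
ring of `K` that contains `k` and has fraction field `K`. -/
structure CurvePoint (k K : Type*) [Field k] [Field K] [Algebra k K] where
  /-- the local ring of the point -/
  ring : ValuationSubring K
  const_mem : ∀ c : k, algebraMap k K c ∈ ring
  dvr : IsDiscreteValuationRing ring

namespace CurvePoint

variable {k K : Type*} [Field k] [Field K] [Algebra k K]

instance (P : CurvePoint k K) : IsDiscreteValuationRing P.ring := P.dvr

instance (P : CurvePoint k K) : Algebra k P.ring :=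
  ((algebraMap k K).codRestrict P.ring.toSubring P.const_mem).toAlgebra

/-- The degree of a point: the degree over `k` of its residue field. -/
def degree (P : CurvePoint k K) : ℕ :=
  Module.finrank k (IsLocalRing.ResidueField P.ring)

/-- The order of vanishing of the rational function `f` at `P`, negative at a pole
(the value at `f = 0` is `0` by convention and is never used). -/
def ord (P : CurvePoint k K) (f : K) : ℤ :=
  -WithZero.log ((IsDiscreteValuationRing.maximalIdeal P.ring).valuation K f)

theorem ord_one (P : CurvePoint k K) : P.ord 1 = 0 := by
  simp [ord]

theorem ord_mul (P : CurvePoint k K) {f g : K} (hf : f ≠ 0) (hg : g ≠ 0) :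
    P.ord (f * g) = P.ord f + P.ord g := by
  have h1 : (IsDiscreteValuationRing.maximalIdeal P.ring).valuation K f ≠ 0 := by simpa using hf
  have h2 : (IsDiscreteValuationRing.maximalIdeal P.ring).valuation K g ≠ 0 := by simpa using hg
  simp only [ord, map_mul, WithZero.log_mul h1 h2]
  ring

theorem ord_inv (P : CurvePoint k K) (f : K) : P.ord f⁻¹ = -P.ord f := by
  simp [ord]

end CurvePoint

/-- The group of divisors. -/
abbrev CurveDivisor (k K : Type*) [Field k] [Field K] [Algebra k K] : Type _ :=
  CurvePoint k K →₀ ℤ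

namespace CurveDivisor

variable {k K : Type*} [Field k] [Field K] [Algebra k K]

/-- `D` is the divisor of the nonzero rational function `f`. -/
def IsDivisorOf (D : CurveDivisor k K) (f : K) : Prop :=
  f ≠ 0 ∧ ∀ P : CurvePoint k K, D P = P.ord f

variable (k K)

/-- The degree homomorphism `∑ n_P P ↦ ∑ n_P deg P`. -/
def deg : CurveDivisor k K →+ ℤ :=
  Finsupp.liftAddHom fun P => AddMonoidHom.mulRight (P.degree : ℤ)

/-- The group of principal divisors. -/
def principal : AddSubgroup (CurveDivisor k K) where
  carrier := {D | ∃ f : K, D.IsDivisorOf f}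
  zero_mem' := ⟨1, one_ne_zero, fun P => by simp [P.ord_one]⟩
  add_mem' := by
    rintro D E ⟨f, hf, hD⟩ ⟨g, hg, hE⟩
    exact ⟨f * g, mul_ne_zero hf hg, fun P => by simp [hD P, hE P, P.ord_mul hf hg]⟩
  neg_mem' := by
    rintro D ⟨f, hf, hD⟩
    exact ⟨f⁻¹, inv_ne_zero hf, fun P => by simp [hD P, P.ord_inv]⟩

/-- The group of divisors of degree `0`. -/
abbrev degZero : AddSubgroup (CurveDivisor k K) := (deg k K).ker

/-- The group of divisor classes of degree `0`: divisors of degree `0` modulo the principal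
divisors. -/
abbrev ClassGroupZero : Type _ :=
  degZero k K ⧸ (principal k K).addSubgroupOf (degZero k K)

end CurveDivisor

/-! ### The genus 2 curve `u² = S(t)` -/

/-- A polynomial of degree `6` without repeated roots (in an algebraic closure). -/
structure SeparableSextic (k : Type*) [Field k] where
  poly : k[X]
  natDegree_eq : poly.natDegree = 6
  separable : poly.Separable

namespace SeparableSextic

variable {k : Type*} [Field k] (S : SeparableSextic k)

/-- The ring `k[t, u] / (u² - S(t))`. -/
abbrev CoordinateRing : Type _ := AdjoinRoot (X ^ 2 - C S.poly : k[X][X])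

theorem prime_equation : Prime (X ^ 2 - C S.poly : k[X][X]) := by
  refine Irreducible.prime ?_
  have hm : (X ^ 2 - C S.poly : k[X][X]).Monic := monic_X_pow_sub_C _ two_ne_zero
  have hd : (X ^ 2 - C S.poly : k[X][X]).natDegree = 2 := natDegree_X_pow_sub_C
  rw [hm.irreducible_iff_roots_eq_zero_of_degree_le_three hd.ge (by rw [hd]; norm_num)]
  refine Multiset.eq_zero_of_forall_notMem fun q hq => ?_
  have hroot : q ^ 2 = S.poly := by
    have := (mem_roots hm.ne_zero).1 hq
    simpa [IsRoot, sub_eq_zero] using this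
  have hu : IsUnit q := S.separable.squarefree q ⟨1, by rw [← hroot]; ring⟩
  have h6 := S.natDegree_eq
  rw [← hroot, natDegree_pow, natDegree_eq_zero_of_isUnit hu] at h6
  omega

instance : IsDomain S.CoordinateRing := AdjoinRoot.isDomain_of_prime S.prime_equation

/-- The function field of the curve `C : u² = S(t)`. -/
abbrev FunctionField : Type _ := FractionRing S.CoordinateRing

/-- A polynomial `y(t)` as a rational function on `C`. -/
def ofPoly (y : k[X]) : S.FunctionField :=
  algebraMap S.CoordinateRing S.FunctionField (AdjoinRoot.of _ y)

/-- The rational function `u` on `C`. -/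
def u : S.FunctionField :=
  algebraMap S.CoordinateRing S.FunctionField (AdjoinRoot.root _)

/-- The group of divisors on (the complete regular model of) `C`. -/
abbrev Divisor : Type _ := CurveDivisor k S.FunctionField

/-- The group `J(C)` of divisor classes of degree `0` on `C`. -/
abbrev Jacobian : Type _ := CurveDivisor.ClassGroupZero k S.FunctionField

/-- `y` has degree at most `3`, and `y² - S` is a nonzero constant times a cube in `k[t]`. -/
def IsMinimal (y : k[X]) : Prop :=
  y.natDegree ≤ 3 ∧ ∃ (α : k) (x : k[X]), α ≠ 0 ∧ y ^ 2 - S.poly = C α * x ^ 3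

end SeparableSextic

end

/-!
The involution `u ↦ -u` turns statements about `f = a(t) + b(t) u` into statements about the norm
`a² - b² S` in `k[t]`. If `y² - S = α x³`, then `y(t) - u` and `y(t) + u` have no common zero and
their product is a cube up to a constant, so every order of `y(t) - u` is divisible by `3`.
Conversely, let `3 D₀ = div h` with `D₀` of degree `0`. Riemann's inequality gives a nonzero section
of `L(D₀ + D_∞)`, where `D_∞` is the polar divisor of `t`, and replaces `D₀` by an equivalent
divisor `D ≥ -D_∞`. Then `3 D = div f` with `f ∈ L(3 D_∞)`, so `f = a(t) + β u` with `β` constant.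
If `β = 0`, then `f` is a constant times a cube in `k[t]` because `[k(C) : k(t)] = 2` is prime to
`3`, and `D` is principal. Otherwise `f` is a constant multiple of some `y(t) - u`, and the norm
`y² - S` is a constant times a cube for the same reason. Both the nonvanishing of `[D]` and the
uniqueness of `y` hold because `L(2 D_∞)` consists of polynomials in `t`.
-/

open Module IsDedekindDomain
open scoped IntermediateField

noncomputable section

/-! ### Orders at a point -/

namespace CurvePoint

variable {k K : Type*} [Field k] [Field K] [Algebra k K] (P : CurvePoint k K)

instance : IsScalarTower k P.ring K := IsScalarTower.of_algebraMap_eq fun _ => rfl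

theorem ring_injective : Function.Injective (ring : CurvePoint k K → ValuationSubring K) := by
  rintro ⟨R, _, _⟩ ⟨R', _, _⟩ rfl
  rfl

theorem ord_zero : P.ord 0 = 0 := by
  simp [ord]

theorem ord_nonneg_iff {f : K} : 0 ≤ P.ord f ↔ f ∈ P.ring := by
  rcases eq_or_ne f 0 with rfl | hf
  · simp [ord_zero]
  set v := (IsDiscreteValuationRing.maximalIdeal P.ring).valuation K
  have hvf : v f ≠ 0 := by simpa using hf
  rw [ord, neg_nonneg, ← WithZero.log_one, WithZero.log_le_log hvf one_ne_zero]
  refine ⟨fun h => ?_, fun h => HeightOneSpectrum.valuation_le_one _ (⟨f, h⟩ : P.ring)⟩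
  obtain ⟨a, rfl⟩ := IsDiscreteValuationRing.exists_lift_of_le_one h
  exact a.2

theorem exists_ord_eq_one : ∃ f : K, P.ord f = 1 := by
  obtain ⟨f, hf⟩ := (IsDiscreteValuationRing.maximalIdeal P.ring).valuation_exists_uniformizer K
  exact ⟨f, by simp [ord, hf]⟩

theorem ne_zero_of_ord_ne_zero {f : K} (h : P.ord f ≠ 0) : f ≠ 0 := by
  rintro rfl
  exact h P.ord_zero

theorem ord_neg (f : K) : P.ord (-f) = P.ord f := by
  simp [ord]

theorem ord_pow (f : K) (n : ℕ) : P.ord (f ^ n) = n * P.ord f := by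
  simp [ord]

theorem ord_zpow (f : K) (n : ℤ) : P.ord (f ^ n) = n * P.ord f := by
  simp [ord]

theorem ord_div {f g : K} (hf : f ≠ 0) (hg : g ≠ 0) : P.ord (f / g) = P.ord f - P.ord g := by
  rw [div_eq_mul_inv, P.ord_mul hf (inv_ne_zero hg), ord_inv, sub_eq_add_neg]

theorem ord_algebraMap (c : k) : P.ord (algebraMap k K c) = 0 := by
  have h := P.ord_nonneg_iff.2 (P.const_mem c)
  have h' := P.ord_nonneg_iff.2 (P.const_mem c⁻¹)
  rw [map_inv₀, ord_inv] at h'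
  omega

theorem le_ord_add {f g : K} {n : ℤ} (hfg : f + g ≠ 0) (hf : f ≠ 0 → n ≤ P.ord f)
    (hg : g ≠ 0 → n ≤ P.ord g) : n ≤ P.ord (f + g) := by
  rcases eq_or_ne f 0 with rfl | hf0
  · rw [zero_add] at hfg ⊢
    exact hg hfg
  rcases eq_or_ne g 0 with rfl | hg0
  · rw [add_zero]
    exact hf hf0
  set v := (IsDiscreteValuationRing.maximalIdeal P.ring).valuation K with hv
  have hvf : v f ≠ 0 := by simpa using hf0
  have hvg : v g ≠ 0 := by simpa using hg0
  have hvfg : v (f + g) ≠ 0 := (Valuation.ne_zero_iff v).2 hfg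
  have hf := hf hf0
  have hg := hg hg0
  simp only [ord, ← hv] at hf hg ⊢
  rcases le_max_iff.1 (v.map_add f g) with h | h
  · rw [← WithZero.log_le_log hvfg hvf] at h
    omega
  · rw [← WithZero.log_le_log hvfg hvg] at h
    omega

theorem le_ord_sub {f g : K} {n : ℤ} (hfg : f - g ≠ 0) (hf : f ≠ 0 → n ≤ P.ord f)
    (hg : g ≠ 0 → n ≤ P.ord g) : n ≤ P.ord (f - g) := by
  rw [sub_eq_add_neg] at hfg ⊢
  exact P.le_ord_add hfg hf fun h => P.ord_neg g ▸ hg (neg_ne_zero.1 h)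

theorem ord_add_eq_left {f g : K} (hf : f ≠ 0) (h : g ≠ 0 → P.ord f < P.ord g) :
    P.ord (f + g) = P.ord f := by
  have hfg : f + g ≠ 0 := by
    intro h0
    have hg : g = -f := (neg_eq_of_add_eq_zero_right h0).symm
    have := h (by simpa [hg] using hf)
    rw [hg, ord_neg] at this
    exact lt_irrefl _ this
  refine le_antisymm ?_ (P.le_ord_add hfg (fun _ => le_rfl) fun hg => (h hg).le)
  by_contra! hlt
  have := P.le_ord_sub (f := f + g) (g := g) (n := P.ord f + 1) (by simpa using hf)
    (fun _ => hlt) h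
  rw [add_sub_cancel_right] at this
  omega

theorem exists_eq_zpow_mul {ϖ f : K} (hϖ : P.ord ϖ = 1) (hf : f ≠ 0) :
    ∃ w : K, P.ord w = 0 ∧ f = ϖ ^ P.ord f * w := by
  have hz : ϖ ^ P.ord f ≠ 0 := zpow_ne_zero _ (P.ne_zero_of_ord_ne_zero (by omega))
  refine ⟨f / ϖ ^ P.ord f, ?_, by field_simp⟩
  rw [P.ord_div hf hz, ord_zpow, hϖ]
  ring

theorem ord_eq_neg_log {v : Valuation K (WithZero (Multiplicative ℤ))}
    (hv : ∀ f ∈ P.ring, v f ≤ 1) (hv1 : ∃ g, v g = WithZero.exp (-1)) (f : K) :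
    P.ord f = -WithZero.log (v f) := by
  obtain ⟨ϖ, hϖ⟩ := P.exists_ord_eq_one
  have hϖ0 : v ϖ ≠ 0 := (v.ne_zero_iff).2 (P.ne_zero_of_ord_ne_zero (by omega))
  have v_unit : ∀ {w}, P.ord w = 0 → w ≠ 0 → v w = 1 := fun {w} hw hw0 => by
    refine le_antisymm (hv w (P.ord_nonneg_iff.1 hw.ge)) ?_
    have := hv w⁻¹ (P.ord_nonneg_iff.1 (by rw [ord_inv, hw, neg_zero]))
    rwa [map_inv₀, inv_le_one₀ (zero_lt_iff.2 (v.ne_zero_iff.2 hw0))] at this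
  have log_eq : ∀ {f}, f ≠ 0 → WithZero.log (v f) = P.ord f * WithZero.log (v ϖ) := by
    intro f hf
    obtain ⟨w, hw, hfw⟩ := P.exists_eq_zpow_mul hϖ hf
    have hw0 : w ≠ 0 := by
      rintro rfl
      exact hf (by rw [hfw, mul_zero])
    conv_lhs => rw [hfw, map_mul, v_unit hw hw0, mul_one, map_zpow₀, WithZero.log_zpow]
    rw [smul_eq_mul]
  obtain ⟨g, hg⟩ := hv1
  have hg0 : g ≠ 0 := (v.ne_zero_iff).1 (by rw [hg]; exact WithZero.exp_ne_zero)
  have hlog : -WithZero.log (v ϖ) = 1 := by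
    refine Int.eq_one_of_dvd_one ?_ ⟨P.ord g, ?_⟩
    · rw [neg_nonneg, ← WithZero.log_one, WithZero.log_le_log hϖ0 one_ne_zero]
      exact hv ϖ (P.ord_nonneg_iff.1 (by omega))
    · have := log_eq hg0
      rw [hg, WithZero.log_exp] at this
      linarith
  rcases eq_or_ne f 0 with rfl | hf
  · simp [ord_zero]
  · linear_combination log_eq hf - P.ord f * hlog

theorem mem_maximalIdeal_iff {f : P.ring} (hf : f ≠ 0) :
    f ∈ IsLocalRing.maximalIdeal P.ring ↔ 0 < P.ord f := by
  have hf0 : (f : K) ≠ 0 := by simpa using hf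
  rw [← ValuationSubring.coe_mem_nonunits_iff, ValuationSubring.mem_nonunits_iff_or,
    or_iff_right hf0, ← P.ord_nonneg_iff, ord_inv, not_le, neg_lt_zero]

theorem mem_ring_of_isIntegral {R : Type*} [CommRing R] [Algebra R K]
    (hR : ∀ r : R, algebraMap R K r ∈ P.ring) {f : K} (hf : IsIntegral R f) : f ∈ P.ring := by
  have hf' : IsIntegral P.ring f :=
    hf.map_of_comp_eq ((algebraMap R K).codRestrict P.ring.toSubring hR) (RingHom.id K) rfl
  obtain ⟨g, rfl⟩ := IsIntegrallyClosed.isIntegral_iff.1 hf'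
  exact g.2

/-- The image of a point under an automorphism `σ` of the function field: a function `f` is
regular at `P.comap σ` when `σ f` is regular at `P`. -/
def comap (σ : K ≃ₐ[k] K) : CurvePoint k K where
  ring := P.ring.comap (σ : K →+* K)
  const_mem c := by simpa [ValuationSubring.mem_comap] using P.const_mem c
  dvr := IsDiscreteValuationRing.RingEquivClass.isDiscreteValuationRing
    ((σ : K ≃+* K).restrict (P.ring.comap (σ : K →+* K)) P.ring fun _ => Iff.rfl).symm

theorem ord_comap (σ : K ≃ₐ[k] K) (f : K) : (P.comap σ).ord f = P.ord (σ f) := by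
  refine ord_eq_neg_log _ (v := ((IsDiscreteValuationRing.maximalIdeal P.ring).valuation K).comap
    (σ : K →+* K)) (fun f hf => ?_) ?_ f
  · exact HeightOneSpectrum.valuation_le_one _ (⟨σ f, hf⟩ : P.ring)
  · obtain ⟨g, hg⟩ := (IsDiscreteValuationRing.maximalIdeal P.ring).valuation_exists_uniformizer K
    exact ⟨σ.symm g, by simpa using hg⟩

theorem degree_comap (σ : K ≃ₐ[k] K) : (P.comap σ).degree = P.degree :=
  Algebra.finrank_eq_of_equiv_equiv (RingEquiv.refl k)
    (IsLocalRing.ResidueField.mapEquiv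
      ((σ : K ≃+* K).restrict (P.comap σ).ring P.ring fun _ => Iff.rfl))
    (RingHom.ext fun c => congrArg (IsLocalRing.residue P.ring) (Subtype.ext (σ.commutes c).symm))

/-- The permutation of the points induced by an automorphism of the function field. -/
def comapEquiv (σ : K ≃ₐ[k] K) : CurvePoint k K ≃ CurvePoint k K where
  toFun P := P.comap σ
  invFun P := P.comap σ.symm
  left_inv P := ring_injective <| by
    ext f
    simp [comap, ValuationSubring.mem_comap]
  right_inv P := ring_injective <| by
    ext f
    simp [comap, ValuationSubring.mem_comap]

end CurvePoint

/-! ### Points and maximal ideals of Dedekind domains -/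

namespace CurvePoint

section Dedekind

variable {k K : Type*} [Field k] [Field K] [Algebra k K]

theorem ring_ne_top (P : CurvePoint k K) : P.ring ≠ ⊤ := by
  intro htop
  obtain ⟨f, hf⟩ := P.exists_ord_eq_one
  have := P.ord_nonneg_iff.2 (htop ▸ ValuationSubring.mem_top f⁻¹)
  rw [ord_inv] at this
  omega

theorem eq_of_ring_le {P Q : CurvePoint k K} (h : P.ring ≤ Q.ring) : P = Q :=
  ring_injective (ValuationSubring.eq_of_le_of_ne_top _ h Q.ring_ne_top)

theorem exists_heightOneSpectrum_mem_iff {B : Type*} [CommRing B] [Algebra B K]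
    [IsFractionRing B K] (P : CurvePoint k K) (hP : ∀ b : B, algebraMap B K b ∈ P.ring) :
    ∃ v : HeightOneSpectrum B, ∀ b ≠ 0, b ∈ v.asIdeal ↔ 0 < P.ord (algebraMap B K b) := by
  let φ : B →+* P.ring := (algebraMap B K).codRestrict P.ring.toSubring hP
  have hφ : ∀ b ≠ 0, φ b ≠ 0 := fun b hb h =>
    hb ((FaithfulSMul.algebraMap_eq_zero_iff B K).1 (congrArg Subtype.val h))
  have mem_iff : ∀ b ≠ 0, b ∈ (IsLocalRing.maximalIdeal P.ring).comap φ ↔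
      0 < P.ord (algebraMap B K b) := fun b hb => P.mem_maximalIdeal_iff (hφ b hb)
  refine ⟨⟨_, Ideal.comap_isPrime φ (IsLocalRing.maximalIdeal P.ring), fun hbot => ?_⟩, mem_iff⟩
  obtain ⟨f, hf⟩ := P.exists_ord_eq_one
  obtain ⟨a, b, -, rfl⟩ := IsFractionRing.div_surjective (A := B) f
  obtain ⟨ha, hb⟩ := div_ne_zero_iff.1 (P.ne_zero_of_ord_ne_zero (hf ▸ one_ne_zero))
  have ha0 : a ≠ 0 := fun h => ha (by rw [h, map_zero])
  have hbord := P.ord_nonneg_iff.2 (hP b)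
  rw [P.ord_div ha hb] at hf
  have ha_mem := (mem_iff a ha0).2 (by omega)
  rw [hbot] at ha_mem
  exact ha0 ha_mem

variable {B : Type*} [CommRing B] [IsDedekindDomain B] [Algebra k B] [Algebra B K]
  [IsScalarTower k B K] [IsFractionRing B K]

variable (k K) in
/-- The point whose local ring is the localization at a maximal ideal of a Dedekind domain with
fraction field `K`. -/
def ofHeightOne (v : HeightOneSpectrum B) : CurvePoint k K where
  ring := HeightOneSpectrum.valuationSubringAtPrime K v
  const_mem c := by
    rw [IsScalarTower.algebraMap_apply k B K, IsScalarTower.algebraMap_apply B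
      (HeightOneSpectrum.valuationSubringAtPrime K v) K]
    exact SetLike.coe_mem _
  dvr := IsLocalization.AtPrime.isDiscreteValuationRing_of_dedekind_domain B v.ne_bot _

theorem ord_ofHeightOne (v : HeightOneSpectrum B) (f : K) :
    (ofHeightOne k K v).ord f = -WithZero.log (v.valuation K f) :=
  ord_eq_neg_log _ (fun _ hf => HeightOneSpectrum.valuationSubringAtPrime_le_valuation v hf)
    (v.valuation_exists_uniformizer K) f

theorem ord_ofHeightOne_pos_iff (v : HeightOneSpectrum B) {b : B} (hb : b ≠ 0) :
    0 < (ofHeightOne k K v).ord (algebraMap B K b) ↔ b ∈ v.asIdeal := by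
  have hv : v.valuation K (algebraMap B K b) ≠ 0 := by simpa using hb
  rw [ord_ofHeightOne, neg_pos, ← WithZero.log_one, WithZero.log_lt_log hv one_ne_zero,
    v.valuation_lt_one_iff_mem]

variable (k K) in
theorem ofHeightOne_injective :
    Function.Injective (ofHeightOne k K : HeightOneSpectrum B → CurvePoint k K) := by
  intro v w h
  ext b
  rcases eq_or_ne b 0 with rfl | hb
  · simp
  rw [← ord_ofHeightOne_pos_iff (k := k) (K := K) v hb, h, ord_ofHeightOne_pos_iff w hb]

theorem exists_ofHeightOne_eq (P : CurvePoint k K) (hP : ∀ b : B, algebraMap B K b ∈ P.ring) :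
    ∃ v : HeightOneSpectrum B, ofHeightOne k K v = P := by
  obtain ⟨v, hv⟩ := P.exists_heightOneSpectrum_mem_iff hP
  refine ⟨v, eq_of_ring_le fun x hx => ?_⟩
  obtain ⟨n, d, hnd⟩ := v.exists_primeCompl_mul_eq_of_integer x
    (HeightOneSpectrum.valuationSubringAtPrime_le_valuation v hx)
  have hd0 : (d : B) ≠ 0 := fun h => d.2 (h ▸ v.asIdeal.zero_mem)
  have hd : P.ord (algebraMap B K d) = 0 :=
    le_antisymm (not_lt.1 (mt (hv d hd0).2 d.2)) (P.ord_nonneg_iff.2 (hP d))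
  rcases eq_or_ne x 0 with rfl | hx0
  · exact P.ring.zero_mem
  have := P.ord_mul hx0 (by simpa using hd0 : algebraMap B K d ≠ 0)
  rw [hnd, hd, add_zero] at this
  rw [← P.ord_nonneg_iff, ← this]
  exact P.ord_nonneg_iff.2 (hP n)

theorem degree_ofHeightOne (v : HeightOneSpectrum B) :
    (ofHeightOne k K v).degree = finrank k (B ⧸ v.asIdeal) := by
  have := v.isMaximal
  let e : B ⧸ v.asIdeal ≃+* IsLocalRing.ResidueField (ofHeightOne k K v).ring :=
    IsLocalization.AtPrime.equivQuotMaximalIdeal v.asIdeal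
      (HeightOneSpectrum.valuationSubringAtPrime K v)
  refine (Algebra.finrank_eq_of_equiv_equiv (RingEquiv.refl k) e (RingHom.ext fun c => ?_)).symm
  exact congrArg (IsLocalRing.residue (ofHeightOne k K v).ring)
    (Subtype.ext (IsScalarTower.algebraMap_apply k B K c))

end Dedekind

section DedekindOverPolynomial

variable {k K : Type*} [Field k] [Field K] [Algebra k K]
variable {B : Type*} [CommRing B] [IsDedekindDomain B] [Algebra k B] [Algebra B K]
  [IsScalarTower k B K] [IsFractionRing B K] [Algebra k[X] B]

theorem ord_ofHeightOne_of_liesOver [Algebra k[X] K] [IsScalarTower k[X] B K]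
    [Module.Finite k[X] B] [Module.IsTorsionFree k[X] B]
    {π : k[X]} (hπ : π ≠ 0) (v : HeightOneSpectrum B) [v.asIdeal.LiesOver (Ideal.span {π})] :
    (ofHeightOne k K v).ord (algebraMap k[X] K π) = v.asIdeal.ramificationIdx k[X] := by
  have hπB : algebraMap k[X] B π ≠ 0 := (FaithfulSMul.algebraMap_eq_zero_iff k[X] B).not.2 hπ
  have hmap : (Ideal.span {π}).map (algebraMap k[X] B) = Ideal.span {algebraMap k[X] B π} := by
    rw [Ideal.map_span, Set.image_singleton]
  have := v.isPrime
  rw [IsScalarTower.algebraMap_apply k[X] B K, ord_ofHeightOne v, v.valuation_of_algebraMap,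
    v.intValuation_eq_exp_neg_multiplicity hπB, WithZero.log_exp, neg_neg,
    Ideal.IsDedekindDomain.ramificationIdx_eq_multiplicity (Ideal.span {π}) v.asIdeal
      (by rw [hmap]; simpa using hπB), hmap]

theorem degree_ofHeightOne_of_liesOver [IsScalarTower k k[X] B] {π : k[X]} (hπ : Irreducible π)
    (v : HeightOneSpectrum B) [v.asIdeal.LiesOver (Ideal.span {π})] :
    (ofHeightOne k K v).degree = π.natDegree * v.asIdeal.inertiaDeg k[X] := by
  have := PrincipalIdealRing.isMaximal_of_irreducible hπ
  have := v.isMaximal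
  let := Ideal.Quotient.field (Ideal.span {π})
  have : IsScalarTower k (k[X] ⧸ Ideal.span {π}) (B ⧸ v.asIdeal) :=
    .of_algebraMap_eq fun c => by
      rw [IsScalarTower.algebraMap_apply k k[X] (k[X] ⧸ Ideal.span {π}),
        ← IsScalarTower.algebraMap_apply k[X] (k[X] ⧸ Ideal.span {π}) (B ⧸ v.asIdeal),
        IsScalarTower.algebraMap_apply k[X] B (B ⧸ v.asIdeal),
        IsScalarTower.algebraMap_apply k B (B ⧸ v.asIdeal),
        IsScalarTower.algebraMap_apply k k[X] B]
  rw [degree_ofHeightOne, Ideal.inertiaDeg_eq_of_isMaximal (Ideal.span {π}) v.asIdeal,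
    ← finrank_quotient_span_eq_natDegree (f := π)]
  exact (finrank_mul_finrank k (k[X] ⧸ Ideal.span {π}) (B ⧸ v.asIdeal)).symm

end DedekindOverPolynomial

end CurvePoint

/-! ### Points over a polynomial in a rational function -/

namespace CurvePoint

variable {k K : Type*} [Field k] [Field K] [Algebra k K] (P : CurvePoint k K) {z : K}

theorem ord_aeval_of_neg (hz : P.ord z < 0) {p : k[X]} (hp : p ≠ 0) :
    P.ord (aeval z p) = p.natDegree * P.ord z := by
  have hz0 : z ≠ 0 := P.ne_zero_of_ord_ne_zero hz.ne
  induction h : p.natDegree using Nat.strong_induction_on generalizing p with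
  | _ n ih =>
    have hlead0 : algebraMap k K p.leadingCoeff ≠ 0 := by simpa using hp
    have hlead : P.ord (algebraMap k K p.leadingCoeff * z ^ n) = n * P.ord z := by
      rw [P.ord_mul hlead0 (pow_ne_zero _ hz0), ord_algebraMap, ord_pow, zero_add]
    have hsum : aeval z p = algebraMap k K p.leadingCoeff * z ^ n + aeval z p.eraseLead := by
      conv_lhs => rw [← p.eraseLead_add_C_mul_X_pow]
      simp [h, add_comm]
    rw [hsum, ← hlead]
    refine P.ord_add_eq_left (mul_ne_zero hlead0 (pow_ne_zero _ hz0)) fun hne => ?_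
    have herase : p.eraseLead ≠ 0 := fun h0 => hne (by rw [h0, map_zero])
    have hdeg : p.eraseLead.natDegree < n :=
      h ▸ p.eraseLead_natDegree_lt_or_eraseLead_eq_zero.resolve_right herase
    rw [hlead, ih _ hdeg herase rfl]
    exact mul_lt_mul_of_neg_right (by exact_mod_cast hdeg) hz

theorem ord_aeval_nonneg (hz : 0 ≤ P.ord z) (p : k[X]) : 0 ≤ P.ord (aeval z p) := by
  have := aeval_algebraMap_apply K (⟨z, P.ord_nonneg_iff.1 hz⟩ : P.ring) p
  rw [P.ord_nonneg_iff]
  exact this ▸ SetLike.coe_mem _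

variable {P}

theorem ord_nonneg_of_ord_aeval_pos {p : k[X]} (h : 0 < P.ord (aeval z p)) : 0 ≤ P.ord z := by
  by_contra! hz
  have hp : p ≠ 0 := by
    rintro rfl
    simp [ord_zero] at h
  rw [P.ord_aeval_of_neg hz hp] at h
  exact h.not_ge (mul_nonpos_of_nonneg_of_nonpos (Nat.cast_nonneg _) hz.le)

theorem aeval_mem_maximalIdeal {ζ : P.ring} {p : k[X]} (hp : 0 < P.ord (aeval (ζ : K) p)) :
    aeval ζ p ∈ IsLocalRing.maximalIdeal P.ring := by
  have hζ : aeval (ζ : K) p = aeval ζ p := aeval_algebraMap_apply K ζ p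
  rw [hζ] at hp
  refine (P.mem_maximalIdeal_iff fun h0 => P.ne_zero_of_ord_ne_zero hp.ne' ?_).2 hp
  rw [h0]
  rfl

theorem ord_aeval_eq_zero_of_isCoprime {p q : k[X]} (hpq : IsCoprime p q)
    (hp : 0 < P.ord (aeval z p)) : P.ord (aeval z q) = 0 := by
  have hz := ord_nonneg_of_ord_aeval_pos hp
  by_contra hq
  let ζ : P.ring := ⟨z, P.ord_nonneg_iff.1 hz⟩
  obtain ⟨a, b, hab⟩ := hpq
  refine (Ideal.ne_top_iff_one _).1 (IsLocalRing.maximalIdeal.isMaximal P.ring).ne_top ?_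
  rw [← map_one (aeval (R := k) ζ), ← hab, map_add, map_mul, map_mul]
  exact add_mem (Ideal.mul_mem_left _ _ (aeval_mem_maximalIdeal hp))
    (Ideal.mul_mem_left _ _ (aeval_mem_maximalIdeal ((P.ord_aeval_nonneg hz q).lt_of_ne' hq)))

theorem dvd_of_ord_aeval_pos {π p : k[X]} (hπ : Irreducible π) (hπP : 0 < P.ord (aeval z π))
    (hp : 0 < P.ord (aeval z p)) : π ∣ p := by
  by_contra h
  exact hp.ne' (ord_aeval_eq_zero_of_isCoprime (hπ.coprime_iff_not_dvd.2 h) hπP)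

theorem natDegree_dvd_degree {π : k[X]} (hπ : Irreducible π) (hπP : 0 < P.ord (aeval z π)) :
    π.natDegree ∣ P.degree := by
  let ζ : P.ring := ⟨z, P.ord_nonneg_iff.1 (ord_nonneg_of_ord_aeval_pos hπP)⟩
  have hroot : aeval (IsLocalRing.residue P.ring ζ) π = 0 :=
    (aeval_algebraMap_apply (IsLocalRing.ResidueField P.ring) ζ π).trans
      ((IsLocalRing.residue_eq_zero_iff _).2 (aeval_mem_maximalIdeal hπP))
  have hint : IsIntegral k (IsLocalRing.residue P.ring ζ) :=
    isAlgebraic_iff_isIntegral.1 ⟨π, hπ.ne_zero, hroot⟩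
  have hmin := minpoly.eq_of_irreducible hπ hroot
  have : π.natDegree = (minpoly k (IsLocalRing.residue P.ring ζ)).natDegree := by
    rw [← hmin, natDegree_mul_C (inv_ne_zero (leadingCoeff_ne_zero.2 hπ.ne_zero))]
  exact this ▸ minpoly.degree_dvd hint

end CurvePoint

namespace CurveDivisor

variable {k K : Type*} [Field k] [Field K] [Algebra k K]

theorem deg_single (P : CurvePoint k K) (n : ℤ) :
    deg k K (Finsupp.single P n) = n * P.degree := by
  simp [deg]

section DedekindOverPolynomial

open CurvePoint

variable [Algebra k[X] K] [IsScalarTower k k[X] K] (B : Type*) [CommRing B]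
  [IsDedekindDomain B] [Algebra k B] [Algebra B K] [IsScalarTower k B K] [IsFractionRing B K]
  [Algebra k[X] B] [IsScalarTower k[X] B K] [Module.Finite k[X] B] [Module.IsTorsionFree k[X] B]
  {π : k[X]} (hπ : Irreducible π)

include B hπ in
theorem exists_primesOver_of_ord_pos {P : CurvePoint k K} (hP : 0 < P.ord (algebraMap k[X] K π)) :
    ∃ v : HeightOneSpectrum B, v.asIdeal.LiesOver (Ideal.span {π}) ∧ ofHeightOne k K v = P := by
  have algebraMap_eq : ∀ p : k[X], algebraMap k[X] K p = aeval (algebraMap k[X] K X) p :=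
    fun p => by rw [aeval_algebraMap_apply, aeval_X_left_apply]
  rw [algebraMap_eq] at hP
  have hX := ord_nonneg_of_ord_aeval_pos hP
  obtain ⟨v, rfl⟩ := P.exists_ofHeightOne_eq (B := B) fun b =>
    P.mem_ring_of_isIntegral (R := k[X])
      (fun p => algebraMap_eq p ▸ P.ord_nonneg_iff.1 (P.ord_aeval_nonneg hX p))
      (Algebra.IsIntegral.isIntegral (R := k[X]) b).algebraMap
  refine ⟨v, ⟨?_⟩, rfl⟩
  have hmax : (Ideal.span {π}).IsMaximal := PrincipalIdealRing.isMaximal_of_irreducible hπ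
  have := v.isPrime
  refine hmax.eq_of_le (Ideal.comap_isPrime (algebraMap k[X] B) v.asIdeal).ne_top ?_
  rw [Ideal.span_singleton_le_iff_mem, Ideal.mem_comap]
  rwa [← algebraMap_eq, IsScalarTower.algebraMap_apply k[X] B K, ord_ofHeightOne_pos_iff] at hP
  exact (FaithfulSMul.algebraMap_eq_zero_iff k[X] B).not.2 hπ.ne_zero

variable [IsScalarTower k k[X] B]

include B hπ in
theorem degree_pos_of_ord_pos {P : CurvePoint k K} (hP : 0 < P.ord (algebraMap k[X] K π)) :
    0 < P.degree := by
  obtain ⟨v, hv, rfl⟩ := exists_primesOver_of_ord_pos B hπ hP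
  have := v.isPrime
  rw [degree_ofHeightOne_of_liesOver hπ v]
  exact Nat.mul_pos hπ.natDegree_pos (v.asIdeal.inertiaDeg_pos k[X])

include B hπ in
theorem exists_zeros_of_dedekind : ∃ D : CurveDivisor k K,
    (∀ P, D P = max 0 (P.ord (algebraMap k[X] K π))) ∧
      deg k K D = finrank k[X] B * π.natDegree := by
  set p : Ideal k[X] := Ideal.span {π}
  have hmax : p.IsMaximal := PrincipalIdealRing.isMaximal_of_irreducible hπ
  have hp0 : p ≠ ⊥ := by simpa [p] using hπ.ne_zero
  let v (q : p.primesOver B) : HeightOneSpectrum B :=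
    ⟨q.1, q.2.1, have := q.2.2; Ideal.ne_bot_of_liesOver_of_ne_bot hp0 q.1⟩
  have hv (q) : (v q).asIdeal.LiesOver p := q.2.2
  have v_injective : Function.Injective v := fun q q' h =>
    Subtype.ext (congrArg HeightOneSpectrum.asIdeal h)
  let pt : p.primesOver B ↪ CurvePoint k K :=
    ⟨fun q => ofHeightOne k K (v q), (ofHeightOne_injective k K).comp v_injective⟩
  have ord_pt (q) : (pt q).ord (algebraMap k[X] K π) = q.1.ramificationIdx k[X] :=
    ord_ofHeightOne_of_liesOver hπ.ne_zero (v q)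
  have degree_pt (q) : (pt q).degree = π.natDegree * q.1.inertiaDeg k[X] :=
    degree_ofHeightOne_of_liesOver hπ (v q)
  refine ⟨Finsupp.embDomain pt (Finsupp.equivFunOnFinite.symm fun q => q.1.ramificationIdx k[X]),
    fun P => ?_, ?_⟩
  · by_cases hP : P ∈ Set.range pt
    · obtain ⟨q, rfl⟩ := hP
      simp [Finsupp.embDomain_apply_self, ord_pt]
    · rw [Finsupp.embDomain_of_notMem_range _ _ _ hP, max_eq_left]
      refine not_lt.1 fun hlt => hP ?_
      obtain ⟨w, hw, rfl⟩ := exists_primesOver_of_ord_pos B hπ hlt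
      exact ⟨⟨w.asIdeal, w.isPrime, hw⟩, rfl⟩
  · rw [deg, Finsupp.liftAddHom_apply, Finsupp.sum_embDomain, Finsupp.sum_fintype _ _ (by simp),
      ← Ideal.sum_ramification_inertia_eq_finrank p B]
    push_cast
    rw [Finset.sum_mul]
    refine Finset.sum_congr rfl fun q _ => ?_
    simp only [degree_pt, Finsupp.equivFunOnFinite_symm_apply_apply]
    push_cast
    ring

end DedekindOverPolynomial

theorem exists_zeros_aeval {z : K} (hz : Transcendental k z) [FiniteDimensional k⟮z⟯ K]
    [Algebra.IsSeparable k⟮z⟯ K] {π : k[X]} (hπ : Irreducible π) :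
    (∃ D : CurveDivisor k K, (∀ P, D P = max 0 (P.ord (aeval z π))) ∧
      deg k K D = finrank k⟮z⟯ K * π.natDegree) ∧
    ∀ P : CurvePoint k K, 0 < P.ord (aeval z π) → 0 < P.degree := by
  let gen := IntermediateField.AdjoinSimple.gen k z
  let : Algebra k[X] K := (aeval z).toAlgebra
  let : Algebra k[X] k⟮z⟯ := (aeval gen).toAlgebra
  have : IsScalarTower k k[X] K := .of_algebraMap_eq fun c => (aeval_C z c).symm
  have coe_aeval (p : k[X]) : aeval z p = (aeval gen p : k⟮z⟯) := aeval_algebraMap_apply K gen p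
  have : IsScalarTower k[X] k⟮z⟯ K := .of_algebraMap_eq coe_aeval
  have : FaithfulSMul k[X] k⟮z⟯ := (faithfulSMul_iff_algebraMap_injective _ _).2 fun p q h =>
    transcendental_iff_injective.1 hz (by rw [coe_aeval, coe_aeval]; exact congrArg _ h)
  have : IsFractionRing k[X] k⟮z⟯ := IsFractionRing.of_field _ _ fun x => by
    obtain ⟨r, s, hx⟩ := (IntermediateField.mem_adjoin_simple_iff k _).1 x.2
    exact ⟨r, s, Subtype.ext (by rw [hx, coe_aeval, coe_aeval]; rfl)⟩
  let B := integralClosure k[X] K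
  have : IsFractionRing B K := integralClosure.isFractionRing_of_finite_extension k⟮z⟯ K
  have : Module.Finite k[X] B := IsIntegralClosure.finite k[X] k⟮z⟯ K B
  have : IsDedekindDomain B := IsIntegralClosure.isDedekindDomain k[X] k⟮z⟯ K B
  have : FaithfulSMul k[X] K := .trans k[X] k⟮z⟯ K
  have : FaithfulSMul k[X] B := .tower_bot k[X] B K
  have : Module.IsTorsionFree k[X] B := inferInstance
  rw [IsFractionRing.finrank_eq k[X] k⟮z⟯ B K]
  exact ⟨exists_zeros_of_dedekind B hπ, fun _ => degree_pos_of_ord_pos B hπ⟩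

end CurveDivisor

/-! ### Divisors of rational functions of one variable -/

section Transcendental

variable {k K : Type*} [Field k] [Field K] [Algebra k K] {z : K}

theorem aeval_ne_zero_of_transcendental (hz : Transcendental k z) {p : k[X]} (hp : p ≠ 0) :
    aeval z p ≠ 0 :=
  (map_ne_zero_iff _ (transcendental_iff_injective.1 hz)).2 hp

theorem adjoin_simple_inv (z : K) : k⟮z⁻¹⟯ = k⟮z⟯ := by
  refine le_antisymm ?_ ?_ <;> rw [IntermediateField.adjoin_simple_le_iff]
  · exact inv_mem (IntermediateField.mem_adjoin_simple_self k z)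
  · exact inv_mem_iff.1 (IntermediateField.mem_adjoin_simple_self k z⁻¹)

theorem transcendental_inv (hz : Transcendental k z) : Transcendental k z⁻¹ :=
  mt IsAlgebraic.inv_iff.1 hz

end Transcendental

namespace CurveDivisor

variable {k K : Type*} [Field k] [Field K] [Algebra k K] {D E : CurveDivisor k K} {f g : K}

theorem IsDivisorOf.mul (hD : D.IsDivisorOf f) (hE : E.IsDivisorOf g) :
    (D + E).IsDivisorOf (f * g) :=
  ⟨mul_ne_zero hD.1 hE.1, fun P => by rw [Finsupp.add_apply, hD.2, hE.2, P.ord_mul hD.1 hE.1]⟩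

theorem IsDivisorOf.inv (hD : D.IsDivisorOf f) : (-D).IsDivisorOf f⁻¹ :=
  ⟨inv_ne_zero hD.1, fun P => by rw [Finsupp.neg_apply, hD.2, P.ord_inv]⟩

theorem IsDivisorOf.pow (hD : D.IsDivisorOf f) (n : ℕ) : (n • D).IsDivisorOf (f ^ n) :=
  ⟨pow_ne_zero n hD.1, fun P => by rw [Finsupp.smul_apply, hD.2, P.ord_pow, nsmul_eq_mul]⟩

theorem IsDivisorOf.algebraMap_mul (hD : D.IsDivisorOf f) {c : k} (hc : c ≠ 0) :
    D.IsDivisorOf (algebraMap k K c * f) := by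
  have hc' : algebraMap k K c ≠ 0 := (_root_.map_ne_zero _).2 hc
  exact ⟨mul_ne_zero hc' hD.1, fun P => by
    rw [P.ord_mul hc' hD.1, P.ord_algebraMap, zero_add, hD.2]⟩

theorem IsDivisorOf.eq (hD : D.IsDivisorOf f) (hE : E.IsDivisorOf f) : D = E :=
  Finsupp.ext fun P => (hD.2 P).trans (hE.2 P).symm

variable {z : K} (hz : Transcendental k z) [FiniteDimensional k⟮z⟯ K]
  [Algebra.IsSeparable k⟮z⟯ K]

include hz in
theorem exists_poles : ∃ D : CurveDivisor k K, (∀ P, D P = max 0 (-P.ord z)) ∧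
    deg k K D = finrank k⟮z⟯ K := by
  have : FiniteDimensional k⟮z⁻¹⟯ K := by rwa [adjoin_simple_inv]
  have : Algebra.IsSeparable k⟮z⁻¹⟯ K := by rwa [adjoin_simple_inv]
  obtain ⟨D, hD, hdeg⟩ := (exists_zeros_aeval (transcendental_inv hz) irreducible_X).1
  refine ⟨D, fun P => by rw [hD, aeval_X, P.ord_inv], ?_⟩
  rw [hdeg, natDegree_X, adjoin_simple_inv, Nat.cast_one, mul_one]

/-- The divisor of poles of a transcendental function `z`. -/
def poles : CurveDivisor k K :=
  (exists_poles hz).choose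

theorem poles_apply (P : CurvePoint k K) : poles hz P = max 0 (-P.ord z) :=
  (exists_poles hz).choose_spec.1 P

theorem poles_of_neg {P : CurvePoint k K} (hP : P.ord z < 0) : poles hz P = -P.ord z := by
  rw [poles_apply, max_eq_right (by omega)]

theorem poles_of_nonneg {P : CurvePoint k K} (hP : 0 ≤ P.ord z) : poles hz P = 0 := by
  rw [poles_apply, max_eq_left (by omega)]

theorem deg_poles : deg k K (poles hz) = finrank k⟮z⟯ K :=
  (exists_poles hz).choose_spec.2

include hz

theorem exists_ord_neg : ∃ P : CurvePoint k K, P.ord z < 0 := by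
  by_contra! h
  have h0 : poles hz = 0 := Finsupp.ext fun P => poles_of_nonneg hz (h P)
  have := deg_poles hz
  rw [h0, map_zero] at this
  exact finrank_pos.ne (by exact_mod_cast this)

theorem exists_ord_aeval_pos {π : k[X]} (hπ : Irreducible π) :
    ∃ P : CurvePoint k K, 0 < P.ord (aeval z π) := by
  obtain ⟨D, hD, hdeg⟩ := (exists_zeros_aeval hz hπ).1
  by_contra! h
  have h0 : D = 0 := Finsupp.ext fun P => by rw [hD, max_eq_left (h P), Finsupp.zero_apply]
  rw [h0, map_zero] at hdeg
  exact (Nat.mul_pos finrank_pos hπ.natDegree_pos).ne (by exact_mod_cast hdeg)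

theorem exists_isDivisorOf_aeval {p : k[X]} (hp : p ≠ 0) :
    ∃ D : CurveDivisor k K, D.IsDivisorOf (aeval z p) ∧ deg k K D = 0 := by
  induction p using WfDvdMonoid.induction_on_irreducible with
  | zero => exact absurd rfl hp
  | unit p hu =>
    obtain ⟨c, -, rfl⟩ := Polynomial.isUnit_iff.1 hu
    exact ⟨0, ⟨aeval_ne_zero_of_transcendental hz hp, fun P => by
      rw [aeval_C, P.ord_algebraMap, Finsupp.zero_apply]⟩, map_zero _⟩
  | mul p π hp0 hπ ih =>
    obtain ⟨D, hD, hD0⟩ := ih hp0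
    obtain ⟨Z, hZ, hZdeg⟩ := (exists_zeros_aeval hz hπ).1
    have hdiv : (Z - π.natDegree • poles hz).IsDivisorOf (aeval z π) := by
      refine ⟨aeval_ne_zero_of_transcendental hz hπ.ne_zero, fun P => ?_⟩
      rw [Finsupp.sub_apply, Finsupp.smul_apply, hZ, nsmul_eq_mul]
      rcases lt_or_ge (P.ord z) 0 with hP | hP
      · rw [poles_of_neg hz hP, P.ord_aeval_of_neg hP hπ.ne_zero, max_eq_left
          (mul_nonpos_of_nonneg_of_nonpos (Nat.cast_nonneg _) hP.le)]
        ring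
      · rw [poles_of_nonneg hz hP, max_eq_right (P.ord_aeval_nonneg hP π), mul_zero, sub_zero]
    refine ⟨_, by rw [map_mul]; exact hdiv.mul hD, ?_⟩
    rw [map_add, map_sub, map_nsmul, hD0, hZdeg, deg_poles, nsmul_eq_mul]
    ring

end CurveDivisor

namespace CurvePoint

variable {k K : Type*} [Field k] [Field K] [Algebra k K] {z : K} (hz : Transcendental k z)

include hz

theorem ord_aeval_mul (P : CurvePoint k K) {p q : k[X]} (hp : p ≠ 0) (hq : q ≠ 0) :
    P.ord (aeval z (p * q)) = P.ord (aeval z p) + P.ord (aeval z q) := by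
  rw [map_mul, P.ord_mul (aeval_ne_zero_of_transcendental hz hp)
    (aeval_ne_zero_of_transcendental hz hq)]

theorem exists_irreducible_ord_aeval_pos [Algebra.IsIntegral k⟮z⟯ K] {P : CurvePoint k K}
    (hP : 0 ≤ P.ord z) : ∃ π : k[X], Irreducible π ∧ 0 < P.ord (aeval z π) := by
  by_contra! h
  have ord_eq_zero (p : k[X]) : P.ord (aeval z p) = 0 := by
    induction p using WfDvdMonoid.induction_on_irreducible with
    | zero => rw [map_zero, P.ord_zero]
    | unit p hu =>
      obtain ⟨c, -, rfl⟩ := Polynomial.isUnit_iff.1 hu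
      rw [aeval_C, P.ord_algebraMap]
    | mul p π hp hπ ih =>
      rw [P.ord_aeval_mul hz hπ.ne_zero hp, ih, add_zero]
      exact (h π hπ).antisymm (P.ord_aeval_nonneg hP π)
  refine P.ring_ne_top (eq_top_iff.2 fun f _ => P.mem_ring_of_isIntegral (R := k⟮z⟯) ?_
    (Algebra.IsIntegral.isIntegral f))
  rintro ⟨x, hx⟩
  obtain ⟨r, s, rfl⟩ := (IntermediateField.mem_adjoin_simple_iff k _).1 hx
  rw [← P.ord_nonneg_iff]
  change 0 ≤ P.ord (aeval z r / aeval z s)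
  rcases eq_or_ne (aeval z r / aeval z s) 0 with h0 | h0
  · rw [h0, P.ord_zero]
  · rw [P.ord_div (div_ne_zero_iff.1 h0).1 (div_ne_zero_iff.1 h0).2, ord_eq_zero, ord_eq_zero,
      sub_zero]

variable [FiniteDimensional k⟮z⟯ K] [Algebra.IsSeparable k⟮z⟯ K]

theorem degree_pos (P : CurvePoint k K) : 0 < P.degree := by
  rcases le_or_gt 0 (P.ord z) with hP | hP
  · obtain ⟨π, hπ, hπP⟩ := exists_irreducible_ord_aeval_pos hz hP
    exact (CurveDivisor.exists_zeros_aeval hz hπ).2 P hπP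
  · have : FiniteDimensional k⟮z⁻¹⟯ K := by rwa [adjoin_simple_inv]
    have : Algebra.IsSeparable k⟮z⁻¹⟯ K := by rwa [adjoin_simple_inv]
    refine (CurveDivisor.exists_zeros_aeval (transcendental_inv hz) irreducible_X).2 P ?_
    rw [aeval_X, P.ord_inv]
    omega

end CurvePoint

namespace CurvePoint

variable {k K : Type*} [Field k] [Field K] [Algebra k K] {z : K} (hz : Transcendental k z)
  [FiniteDimensional k⟮z⟯ K]

include hz

theorem exists_le_ord_aeval (D : CurveDivisor k K) :
    ∃ p : k[X], p ≠ 0 ∧ ∀ P : CurvePoint k K, 0 ≤ P.ord z → D P ≤ P.ord (aeval z p) := by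
  classical
  induction D using Finsupp.induction_linear with
  | zero => exact ⟨1, one_ne_zero, fun P hP => P.ord_aeval_nonneg hP 1⟩
  | add D E hD hE =>
    obtain ⟨p, hp, hDp⟩ := hD
    obtain ⟨q, hq, hEq⟩ := hE
    exact ⟨p * q, mul_ne_zero hp hq, fun P hP =>
      (add_le_add (hDp P hP) (hEq P hP)).trans_eq (P.ord_aeval_mul hz hp hq).symm⟩
  | single Q n =>
    by_cases hQ : 0 ≤ Q.ord z
    · obtain ⟨π, hπ, hπQ⟩ := exists_irreducible_ord_aeval_pos hz hQ
      refine ⟨π ^ n.natAbs, pow_ne_zero _ hπ.ne_zero, fun P hP => ?_⟩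
      rcases eq_or_ne Q P with rfl | hne
      · rw [Finsupp.single_eq_same, map_pow, Q.ord_pow]
        nlinarith [Int.le_natAbs (a := n), Int.natCast_nonneg n.natAbs]
      · rw [Finsupp.single_apply, if_neg hne]
        exact P.ord_aeval_nonneg hP _
    · refine ⟨1, one_ne_zero, fun P hP => ?_⟩
      rw [Finsupp.single_apply, if_neg (by rintro rfl; exact hQ hP)]
      exact P.ord_aeval_nonneg hP 1

variable [Algebra.IsSeparable k⟮z⟯ K]

theorem dvd_of_ord_aeval_le {a c : k[X]} (ha : a ≠ 0) (hc : c ≠ 0)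
    (h : ∀ P : CurvePoint k K, 0 ≤ P.ord z → P.ord (aeval z c) ≤ P.ord (aeval z a)) : c ∣ a := by
  induction c using WfDvdMonoid.induction_on_irreducible generalizing a with
  | zero => exact absurd rfl hc
  | unit c hu => exact hu.dvd
  | mul c π hc0 hπ ih =>
    obtain ⟨P, hπP⟩ := CurveDivisor.exists_ord_aeval_pos hz hπ
    have hP := ord_nonneg_of_ord_aeval_pos hπP
    have haP := h P hP
    rw [P.ord_aeval_mul hz hπ.ne_zero hc0] at haP
    obtain ⟨a, rfl⟩ := dvd_of_ord_aeval_pos (p := a) hπ hπP (by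
      linarith [P.ord_aeval_nonneg hP c])
    have ha0 := right_ne_zero_of_mul ha
    refine mul_dvd_mul_left π (ih ha0 hc0 fun Q hQ => ?_)
    have haQ := h Q hQ
    rwa [Q.ord_aeval_mul hz hπ.ne_zero hc0, Q.ord_aeval_mul hz hπ.ne_zero ha0,
      add_le_add_iff_left] at haQ

/-- Summing `i * ord_P π * deg P` over the zeros of `π` gives `i * [K : k(z)] * deg π`, while
`deg π` divides the degree of each of those zeros. -/
theorem dvd_of_dvd_ord_aeval_pow {n i : ℕ} (hn : n.Coprime (finrank k⟮z⟯ K)) {π : k[X]}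
    (hπ : Irreducible π)
    (h : ∀ P : CurvePoint k K, 0 ≤ P.ord z → (n : ℤ) ∣ P.ord (aeval z (π ^ i))) : n ∣ i := by
  obtain ⟨D, hD, hdeg⟩ := (CurveDivisor.exists_zeros_aeval hz hπ).1
  have hsum : (n * π.natDegree : ℤ) ∣ i * CurveDivisor.deg k K D := by
    rw [CurveDivisor.deg, Finsupp.liftAddHom_apply, Finsupp.sum, Finset.mul_sum]
    refine Finset.dvd_sum fun P hP => ?_
    have hDP : 0 < P.ord (aeval z π) := by
      by_contra! hle
      exact Finsupp.mem_support_iff.1 hP (by rw [hD, max_eq_left hle])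
    have hord := h P (ord_nonneg_of_ord_aeval_pos hDP)
    rw [map_pow, ord_pow] at hord
    rw [hD, max_eq_right hDP.le, AddMonoidHom.coe_mulRight, ← mul_assoc]
    exact mul_dvd_mul hord (Int.natCast_dvd_natCast.2 (natDegree_dvd_degree hπ hDP))
  rw [hdeg, ← mul_assoc] at hsum
  have hmul : n ∣ i * finrank k⟮z⟯ K :=
    Nat.dvd_of_mul_dvd_mul_right hπ.natDegree_pos (by exact_mod_cast hsum)
  exact hn.dvd_of_dvd_mul_right hmul

theorem exists_eq_C_mul_pow {n : ℕ} (hn : n.Coprime (finrank k⟮z⟯ K)) {p : k[X]} (hp : p ≠ 0)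
    (h : ∀ P : CurvePoint k K, 0 ≤ P.ord z → (n : ℤ) ∣ P.ord (aeval z p)) :
    ∃ (α : k) (x : k[X]), α ≠ 0 ∧ p = C α * x ^ n := by
  induction p using UniqueFactorizationMonoid.induction_on_coprime with
  | h0 => exact absurd rfl hp
  | h1 hu =>
    obtain ⟨c, hc, rfl⟩ := Polynomial.isUnit_iff.1 hu
    exact ⟨c, 1, hc.ne_zero, by rw [one_pow, mul_one]⟩
  | hpr i hπ =>
    obtain ⟨j, rfl⟩ := dvd_of_dvd_ord_aeval_pow hz hn hπ.irreducible h
    exact ⟨1, _ ^ j, one_ne_zero, by rw [C_1, one_mul, ← pow_mul, mul_comm]⟩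
  | @hcp p q hpq ihp ihq =>
    have hp0 := left_ne_zero_of_mul hp
    have hq0 := right_ne_zero_of_mul hp
    have hdvd (P : CurvePoint k K) (hP : 0 ≤ P.ord z) :
        (n : ℤ) ∣ P.ord (aeval z p) ∧ (n : ℤ) ∣ P.ord (aeval z q) := by
      have hsum := h P hP
      rw [P.ord_aeval_mul hz hp0 hq0] at hsum
      rcases (P.ord_aeval_nonneg hP p).eq_or_lt with h0 | hpos
      · simpa [← h0] using hsum
      · simpa [ord_aeval_eq_zero_of_isCoprime hpq.isCoprime hpos] using hsum
    obtain ⟨α, x, hα, rfl⟩ := ihp hp0 fun P hP => (hdvd P hP).1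
    obtain ⟨β, y, hβ, rfl⟩ := ihq hq0 fun P hP => (hdvd P hP).2
    exact ⟨α * β, x * y, mul_ne_zero hα hβ, by rw [C_mul, mul_pow]; ring⟩

end CurvePoint

namespace CurveDivisor

variable {k K : Type*} [Field k] [Field K] [Algebra k K] {z : K} (hz : Transcendental k z)
  [FiniteDimensional k⟮z⟯ K] [Algebra.IsSeparable k⟮z⟯ K]

include hz

theorem mem_principal_of_nsmul_isDivisorOf_aeval {n : ℕ} (hn0 : n ≠ 0)
    (hn : n.Coprime (finrank k⟮z⟯ K)) {D : CurveDivisor k K} {p : k[X]}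
    (hD : (n • D).IsDivisorOf (aeval z p)) : D ∈ principal k K := by
  have hp : p ≠ 0 := by
    rintro rfl
    exact hD.1 (map_zero _)
  obtain ⟨α, x, hα, rfl⟩ := CurvePoint.exists_eq_C_mul_pow hz hn hp fun P _ => by
    rw [← hD.2, Finsupp.smul_apply, nsmul_eq_mul]
    exact dvd_mul_right _ _
  have hx : x ≠ 0 := by
    rintro rfl
    exact hp (by rw [zero_pow hn0, mul_zero])
  obtain ⟨E, hE, -⟩ := exists_isDivisorOf_aeval hz hx
  have hnE := (hE.pow n).algebraMap_mul hα
  rw [map_mul, aeval_C, map_pow] at hD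
  rw [nsmul_right_injective hn0 (hD.eq hnE)]
  exact ⟨_, hE⟩

end CurveDivisor

/-! ### Riemann–Roch spaces -/

namespace CurveDivisor

variable {k K : Type*} [Field k] [Field K] [Algebra k K]

/-- The Riemann–Roch space `L(D)`: the functions `f` with `div f + D ≥ 0`, together with `0`. -/
def riemannRochSpace (D : CurveDivisor k K) : Submodule k K where
  carrier := {f | f ≠ 0 → ∀ P, -D P ≤ P.ord f}
  zero_mem' := fun h => absurd rfl h
  add_mem' := fun hf hg hfg P => P.le_ord_add hfg (fun h => hf h P) fun h => hg h P
  smul_mem' := fun c f hf hcf P => by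
    rw [Algebra.smul_def] at hcf ⊢
    rw [P.ord_mul (left_ne_zero_of_mul hcf) (right_ne_zero_of_mul hcf), P.ord_algebraMap, zero_add]
    exact hf (right_ne_zero_of_mul hcf) P

theorem mem_riemannRochSpace_iff {D : CurveDivisor k K} {f : K} (hf : f ≠ 0) :
    f ∈ riemannRochSpace D ↔ ∀ P, -D P ≤ P.ord f :=
  ⟨fun h => h hf, fun h _ => h⟩

theorem mul_mem_riemannRochSpace_sub {D E : CurveDivisor k K} {f g : K} (hE : E.IsDivisorOf g)
    (hf : f ∈ riemannRochSpace D) : f * g ∈ riemannRochSpace (D - E) := by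
  intro hfg P
  have hf0 := left_ne_zero_of_mul hfg
  have := hf hf0 P
  rw [P.ord_mul hf0 hE.1, Finsupp.sub_apply, hE.2]
  omega

theorem mul_mem_riemannRochSpace_add {D E : CurveDivisor k K} {f g : K}
    (hf : f ∈ riemannRochSpace D) (hg : g ∈ riemannRochSpace E) :
    f * g ∈ riemannRochSpace (D + E) := by
  intro hfg P
  have hf0 := left_ne_zero_of_mul hfg
  have hg0 := right_ne_zero_of_mul hfg
  have := hf hf0 P
  have := hg hg0 P
  rw [P.ord_mul hf0 hg0, Finsupp.add_apply]
  omega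

theorem mem_riemannRochSpace_of_pow_mem {D E : CurveDivisor k K} {f : K} {n : ℕ} (hn : 0 < n)
    (hf : f ^ n ∈ riemannRochSpace D) (hDE : D ≤ n • E) : f ∈ riemannRochSpace E := by
  intro hf0 P
  have hfP := hf (pow_ne_zero n hf0) P
  have hDEP := hDE P
  rw [P.ord_pow] at hfP
  rw [Finsupp.smul_apply, nsmul_eq_mul] at hDEP
  refine le_of_mul_le_mul_left (a := (n : ℤ)) ?_ (by exact_mod_cast hn)
  linarith

/-- `f ↦ (ϖ ^ A_P * f) mod 𝔪_P`, for a uniformizer `ϖ` at `P`, embeds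
`L(A) / L(A - P)` into the residue field of `P`. -/
theorem exists_linearMap_residueField (A : CurveDivisor k K) (P : CurvePoint k K) :
    ∃ φ : riemannRochSpace A →ₗ[k] IsLocalRing.ResidueField P.ring,
      ∀ f, φ f = 0 → (f : K) ∈ riemannRochSpace (A - Finsupp.single P 1) := by
  classical
  obtain ⟨ϖ, hϖ⟩ := P.exists_ord_eq_one
  have hϖ0 : ϖ ^ A P ≠ 0 := zpow_ne_zero _ (P.ne_zero_of_ord_ne_zero (hϖ ▸ one_ne_zero))
  have ord_mul_eq {f : K} (hf : f ≠ 0) : P.ord (ϖ ^ A P * f) = A P + P.ord f := by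
    rw [P.ord_mul hϖ0 hf, P.ord_zpow, hϖ, mul_one]
  have mem_ring (f : riemannRochSpace A) : ϖ ^ A P * (f : K) ∈ P.ring := by
    rw [← P.ord_nonneg_iff]
    rcases eq_or_ne (f : K) 0 with h0 | h0
    · rw [h0, mul_zero, P.ord_zero]
    · have := f.2 h0 P
      rw [ord_mul_eq h0]
      omega
  let ψ : riemannRochSpace A →ₗ[k] P.ring :=
    { toFun := fun f => ⟨ϖ ^ A P * f, mem_ring f⟩
      map_add' := fun f g => Subtype.ext (mul_add _ _ _)
      map_smul' := fun c f => Subtype.ext (by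
        change ϖ ^ A P * (c • (f : K)) = algebraMap k K c * (ϖ ^ A P * (f : K))
        rw [Algebra.smul_def]
        ring) }
  refine ⟨(IsScalarTower.toAlgHom k P.ring (IsLocalRing.ResidueField P.ring)).toLinearMap ∘ₗ ψ,
    fun f hf hf0 Q => ?_⟩
  have hQ := f.2 hf0 Q
  rcases eq_or_ne P Q with rfl | hPQ
  · have hψ0 : ψ f ≠ 0 := fun h0 => mul_ne_zero hϖ0 hf0 (congrArg Subtype.val h0)
    have hpos := (P.mem_maximalIdeal_iff hψ0).1 ((IsLocalRing.residue_eq_zero_iff _).1 hf)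
    change 0 < P.ord (ϖ ^ A P * f) at hpos
    rw [ord_mul_eq hf0] at hpos
    rw [Finsupp.sub_apply, Finsupp.single_eq_same]
    omega
  · rwa [Finsupp.sub_apply, Finsupp.single_apply, if_neg hPQ, sub_zero]

variable (V : Submodule k K) [FiniteDimensional k V]

theorem finrank_inf_riemannRochSpace_le_single (A : CurveDivisor k K) {P : CurvePoint k K}
    (hP : 0 < P.degree) :
    finrank k ↥(V ⊓ riemannRochSpace A) ≤
      finrank k ↥(V ⊓ riemannRochSpace (A - Finsupp.single P 1)) + P.degree := by
  obtain ⟨φ, hφ⟩ := exists_linearMap_residueField A P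
  set W := V ⊓ riemannRochSpace (A - Finsupp.single P 1)
  have : FiniteDimensional k ↥(V ⊓ riemannRochSpace A) :=
    Submodule.finiteDimensional_of_le inf_le_left
  have : FiniteDimensional k W := Submodule.finiteDimensional_of_le inf_le_left
  have : Module.Finite k (IsLocalRing.ResidueField P.ring) := Module.finite_of_finrank_pos hP
  let ψ := φ ∘ₗ Submodule.inclusion (inf_le_right : V ⊓ riemannRochSpace A ≤ _)
  let ι : LinearMap.ker ψ →ₗ[k] W :=
    LinearMap.codRestrict W ((V ⊓ riemannRochSpace A).subtype ∘ₗ (LinearMap.ker ψ).subtype)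
      fun f => ⟨f.1.2.1, hφ _ f.2⟩
  have hker : finrank k (LinearMap.ker ψ) ≤ finrank k W :=
    LinearMap.finrank_le_finrank_of_injective (f := ι) fun f g h =>
      Subtype.ext (Subtype.ext (congrArg (fun w : W => (w : K)) h))
  have hrange : finrank k (LinearMap.range ψ) ≤ P.degree := Submodule.finrank_le _
  have := ψ.finrank_range_add_finrank_ker
  omega

theorem finrank_inf_riemannRochSpace_le_single_natCast (A : CurveDivisor k K)
    {P : CurvePoint k K} (hP : 0 < P.degree) (n : ℕ) :
    finrank k ↥(V ⊓ riemannRochSpace A) ≤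
      finrank k ↥(V ⊓ riemannRochSpace (A - Finsupp.single P (n : ℤ))) + n * P.degree := by
  induction n with
  | zero => rw [Nat.cast_zero, Finsupp.single_zero, sub_zero, zero_mul, add_zero]
  | succ n ih =>
    have := finrank_inf_riemannRochSpace_le_single V (A - Finsupp.single P (n : ℤ)) hP
    rw [sub_sub, ← Finsupp.single_add] at this
    push_cast
    linarith

theorem finrank_inf_riemannRochSpace_le (hdeg : ∀ P : CurvePoint k K, 0 < P.degree)
    {A D : CurveDivisor k K} (hDA : D ≤ A) :
    (finrank k ↥(V ⊓ riemannRochSpace A) : ℤ) ≤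
      finrank k ↥(V ⊓ riemannRochSpace D) + deg k K (A - D) := by
  obtain ⟨E, rfl⟩ : ∃ E, D = A - E := ⟨A - D, (sub_sub_cancel A D).symm⟩
  replace hDA : ∀ P, 0 ≤ E P := sub_le_self_iff A |>.1 hDA
  rw [sub_sub_cancel]
  induction E using Finsupp.induction with
  | zero => rw [sub_zero, map_zero, add_zero]
  | single_add P n E hPE hn ih =>
    classical
    have hE (Q) : 0 ≤ E Q := by
      rcases eq_or_ne P Q with rfl | hPQ
      · rw [Finsupp.notMem_support_iff.1 hPE]
      · simpa [Finsupp.single_apply, hPQ] using hDA Q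
    lift n to ℕ using by simpa [Finsupp.notMem_support_iff.1 hPE] using hDA P
    have hstep := finrank_inf_riemannRochSpace_le_single_natCast V (A - E) (hdeg P) n
    rw [sub_sub, add_comm E] at hstep
    rw [map_add, deg_single]
    have := ih hE
    zify at hstep
    linarith

end CurveDivisor

/-! ### Hyperelliptic function fields -/

namespace CurveDivisor

variable {k K : Type*} [Field k] [Field K] [Algebra k K] {D : CurveDivisor k K} {f : K}

theorem IsDivisorOf.exists_map (hD : D.IsDivisorOf f) (σ : K ≃ₐ[k] K) :
    ∃ E : CurveDivisor k K, E.IsDivisorOf (σ f) ∧ deg k K E = deg k K D := by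
  refine ⟨D.equivMapDomain (CurvePoint.comapEquiv σ).symm, ⟨σ.map_ne_zero_iff.2 hD.1, fun P => ?_⟩,
    ?_⟩
  · rw [Finsupp.equivMapDomain_apply, Equiv.symm_symm, hD.2, ← P.ord_comap]
    rfl
  · rw [Finsupp.equivMapDomain_eq_mapDomain, deg, Finsupp.liftAddHom_apply,
      Finsupp.sum_mapDomain_index_addMonoidHom]
    refine Finsupp.sum_congr fun P _ => ?_
    rw [← ((CurvePoint.comapEquiv σ).symm P).degree_comap σ]
    exact congrArg (fun Q : CurvePoint k K => D P * (Q.degree : ℤ))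
      ((CurvePoint.comapEquiv σ).apply_symm_apply P)

end CurveDivisor

/-- A presentation of `K` as the function field of a hyperelliptic curve `u² = S(t)` of genus `g`
with two geometric points over `t = ∞`: the polynomial `S` is squarefree of degree `2g + 2`, the
characteristic is not `2`, and `σ` is the hyperelliptic involution. -/
structure HyperellipticModel (k K : Type*) [Field k] [Field K] [Algebra k K] (g : ℕ) where
  /-- the polynomial `S` -/
  poly : k[X]
  t : K
  u : K
  σ : K ≃ₐ[k] K
  two_ne_zero : (2 : k) ≠ 0
  natDegree_eq : poly.natDegree = 2 * g + 2
  squarefree : Squarefree poly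
  u_sq : u ^ 2 = aeval t poly
  transcendental : Transcendental k t
  exists_eq : ∀ f : K, ∃ a b c : k[X],
    aeval t c ≠ 0 ∧ f * aeval t c = aeval t a + aeval t b * u
  map_t : σ t = t
  map_u : σ u = -u

namespace HyperellipticModel

variable {k K : Type*} [Field k] [Field K] [Algebra k K] {g : ℕ} (M : HyperellipticModel k K g)

theorem map_aeval (p : k[X]) : M.σ (aeval M.t p) = aeval M.t p := by
  rw [← M.σ.coe_toAlgHom, ← aeval_algHom_apply, M.σ.coe_toAlgHom, M.map_t]

theorem aeval_ne_zero {p : k[X]} (hp : p ≠ 0) : aeval M.t p ≠ 0 :=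
  aeval_ne_zero_of_transcendental M.transcendental hp

theorem poly_ne_zero : M.poly ≠ 0 :=
  M.squarefree.ne_zero

theorem u_ne_zero : M.u ≠ 0 := fun h0 => M.aeval_ne_zero M.poly_ne_zero (by
  rw [← M.u_sq, h0, zero_pow _root_.two_ne_zero])

include M in
theorem two_ne_zero_functionField : (2 : K) ≠ 0 := by
  have := (map_ne_zero (algebraMap k K)).2 M.two_ne_zero
  rwa [map_ofNat] at this

theorem u_notMem_adjoin : M.u ∉ k⟮M.t⟯ := fun hu => by
  obtain ⟨r, s, hrs⟩ := (IntermediateField.mem_adjoin_simple_iff k _).1 hu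
  have hfix : M.σ M.u = M.u := by rw [hrs, map_div₀, M.map_aeval, M.map_aeval]
  rw [M.map_u, neg_eq_iff_add_eq_zero, ← two_mul] at hfix
  exact mul_ne_zero M.two_ne_zero_functionField M.u_ne_zero hfix

theorem map_aeval_add_aeval_mul_u (a b : k[X]) :
    M.σ (aeval M.t a + aeval M.t b * M.u) = aeval M.t a - aeval M.t b * M.u := by
  rw [map_add, map_mul, M.map_aeval, M.map_aeval, M.map_u, mul_neg, sub_eq_add_neg]

theorem mul_map_aeval_add_aeval_mul_u (a b : k[X]) :
    (aeval M.t a + aeval M.t b * M.u) * M.σ (aeval M.t a + aeval M.t b * M.u) =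
      aeval M.t (a ^ 2 - b ^ 2 * M.poly) := by
  rw [M.map_aeval_add_aeval_mul_u, map_sub, map_mul, map_pow, map_pow, ← M.u_sq]
  ring

theorem eq_zero_of_aeval_add_aeval_mul_u_eq_zero {a b : k[X]}
    (h : aeval M.t a + aeval M.t b * M.u = 0) : a = 0 ∧ b = 0 := by
  have hσ := congrArg M.σ h
  rw [M.map_aeval_add_aeval_mul_u, map_zero] at hσ
  constructor <;> by_contra hne
  · exact mul_ne_zero M.two_ne_zero_functionField (M.aeval_ne_zero hne)
      (by linear_combination h + hσ)
  · exact mul_ne_zero (mul_ne_zero M.two_ne_zero_functionField (M.aeval_ne_zero hne)) M.u_ne_zero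
      (by linear_combination h - hσ)

theorem eq_and_eq_of_aeval_add_aeval_mul_u_eq {a b a' b' : k[X]}
    (h : aeval M.t a + aeval M.t b * M.u = aeval M.t a' + aeval M.t b' * M.u) :
    a = a' ∧ b = b' := by
  have := M.eq_zero_of_aeval_add_aeval_mul_u_eq_zero (a := a - a') (b := b - b') (by
    rw [map_sub, map_sub]
    linear_combination h)
  exact ⟨sub_eq_zero.1 this.1, sub_eq_zero.1 this.2⟩

theorem coe_aeval_gen (p : k[X]) :
    ((aeval (IntermediateField.AdjoinSimple.gen k M.t) p : k⟮M.t⟯) : K) = aeval M.t p :=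
  (aeval_algebraMap_apply K (IntermediateField.AdjoinSimple.gen k M.t) p).symm

theorem adjoin_u_eq_top : k⟮M.t⟯⟮M.u⟯ = ⊤ := by
  have aeval_mem (p : k[X]) : aeval M.t p ∈ k⟮M.t⟯⟮M.u⟯ := by
    rw [← M.coe_aeval_gen]
    exact k⟮M.t⟯⟮M.u⟯.algebraMap_mem _
  refine eq_top_iff.2 fun f _ => ?_
  obtain ⟨a, b, c, hc, hf⟩ := M.exists_eq f
  rw [eq_div_of_mul_eq hc hf]
  exact div_mem (add_mem (aeval_mem a) (mul_mem (aeval_mem b)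
    (IntermediateField.mem_adjoin_simple_self _ _))) (aeval_mem c)

/-- The polynomial `U² - S(t)` over `k(t)`. -/
def equation : k⟮M.t⟯[X] :=
  X ^ 2 - C (aeval (IntermediateField.AdjoinSimple.gen k M.t) M.poly)

theorem aeval_u_equation : aeval M.u M.equation = 0 := by
  rw [equation, map_sub, map_pow, aeval_X, aeval_C, M.u_sq, sub_eq_zero]
  exact (M.coe_aeval_gen M.poly).symm

theorem isIntegral_u : IsIntegral k⟮M.t⟯ M.u :=
  ⟨M.equation, monic_X_pow_sub_C _ _root_.two_ne_zero, M.aeval_u_equation⟩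

theorem isSeparable_u : IsSeparable k⟮M.t⟯ M.u := by
  refine Separable.of_dvd (separable_X_pow_sub_C _ ?_ ?_) (minpoly.dvd _ _ M.aeval_u_equation)
  · have := (map_ne_zero (algebraMap k k⟮M.t⟯)).2 M.two_ne_zero
    rwa [map_ofNat] at this
  · exact fun h0 => M.aeval_ne_zero M.poly_ne_zero (by rw [← M.coe_aeval_gen, h0]; rfl)

theorem natDegree_minpoly_u : (minpoly k⟮M.t⟯ M.u).natDegree = 2 := by
  refine le_antisymm ?_ ((minpoly.two_le_natDegree_iff M.isIntegral_u).2 ?_)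
  · have hmonic : M.equation.Monic := monic_X_pow_sub_C _ _root_.two_ne_zero
    exact (natDegree_le_of_dvd (minpoly.dvd _ _ M.aeval_u_equation) hmonic.ne_zero).trans_eq
      natDegree_X_pow_sub_C
  · rintro ⟨x, hx⟩
    exact M.u_notMem_adjoin (hx ▸ x.2)

theorem finrank_eq_two : finrank k⟮M.t⟯ K = 2 := by
  rw [← IntermediateField.finrank_top' (F := k⟮M.t⟯), ← M.adjoin_u_eq_top,
    IntermediateField.adjoin.finrank M.isIntegral_u, M.natDegree_minpoly_u]

instance : FiniteDimensional k⟮M.t⟯ K :=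
  finite_of_finrank_pos (by rw [M.finrank_eq_two]; exact two_pos)

instance : Algebra.IsSeparable k⟮M.t⟯ K := by
  have :=
    (IntermediateField.isSeparable_adjoin_simple_iff_isSeparable k⟮M.t⟯ K).2 M.isSeparable_u
  rw [M.adjoin_u_eq_top] at this
  exact .of_algHom k⟮M.t⟯ (⊤ : IntermediateField k⟮M.t⟯ K)
    (IntermediateField.topEquiv (F := k⟮M.t⟯) (E := K)).symm.toAlgHom

end HyperellipticModel

theorem dvd_of_sq_dvd_sq_mul {R : Type*} [CommRing R] [IsDomain R] [UniqueFactorizationMonoid R]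
    {b c s : R} (hs : Squarefree s) (h : c ^ 2 ∣ b ^ 2 * s) : c ∣ b := by
  rcases eq_or_ne c 0 with rfl | hc
  · rw [zero_pow two_ne_zero, zero_dvd_iff, mul_eq_zero, or_iff_left hs.ne_zero] at h
    rw [pow_eq_zero_iff two_ne_zero |>.1 h]
  obtain ⟨d, hd⟩ : c ∣ b * s := by
    rw [← IsIntegrallyClosed.pow_dvd_pow_iff two_ne_zero, mul_pow]
    exact h.trans (mul_dvd_mul_left _ (dvd_pow_self s two_ne_zero))
  obtain ⟨w, hw⟩ := h
  have hsd : s ∣ d ^ 2 := ⟨w, mul_left_cancel₀ (pow_ne_zero 2 hc) (by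
    linear_combination (-(b * s) - c * d) * hd + s * hw)⟩
  obtain ⟨e, rfl⟩ := (hs.dvd_pow_iff_dvd two_ne_zero).1 hsd
  exact ⟨e, mul_right_cancel₀ hs.ne_zero (by linear_combination hd)⟩

namespace CurveDivisor

variable {k K : Type*} [Field k] [Field K] [Algebra k K] {z : K} (hz : Transcendental k z)
  [FiniteDimensional k⟮z⟯ K] [Algebra.IsSeparable k⟮z⟯ K]

include hz in
theorem dvd_of_mul_aeval_eq {f : K} {a c : k[X]} (hc : c ≠ 0)
    (hf : ∀ P : CurvePoint k K, 0 ≤ P.ord z → 0 ≤ P.ord f) (h : f * aeval z c = aeval z a) :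
    c ∣ a := by
  rcases eq_or_ne a 0 with rfl | ha
  · exact dvd_zero c
  refine CurvePoint.dvd_of_ord_aeval_le hz ha hc fun P hP => ?_
  have hf0 : f ≠ 0 := by
    rintro rfl
    exact aeval_ne_zero_of_transcendental hz ha (by rw [← h, zero_mul])
  rw [← h, P.ord_mul hf0 (aeval_ne_zero_of_transcendental hz hc)]
  exact le_add_of_nonneg_left (hf P hP)

theorem mem_riemannRochSpace_smul_poles_iff {f : K} (hf : f ≠ 0) {n : ℕ} :
    f ∈ riemannRochSpace (n • poles hz) ↔
      (∀ P : CurvePoint k K, 0 ≤ P.ord z → 0 ≤ P.ord f) ∧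
        ∀ P : CurvePoint k K, P.ord z < 0 → n * P.ord z ≤ P.ord f := by
  simp only [mem_riemannRochSpace_iff hf, Finsupp.smul_apply, nsmul_eq_mul]
  refine ⟨fun h => ⟨fun P hP => ?_, fun P hP => ?_⟩, fun h P => ?_⟩
  · simpa [poles_of_nonneg hz hP] using h P
  · simpa [poles_of_neg hz hP] using h P
  · rcases lt_or_ge (P.ord z) 0 with hP | hP
    · simpa [poles_of_neg hz hP] using h.2 P hP
    · simpa [poles_of_nonneg hz hP] using h.1 P hP

theorem aeval_mem_riemannRochSpace_smul_poles_iff {a : k[X]} {n : ℕ} :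
    aeval z a ∈ riemannRochSpace (n • poles hz) ↔ a.natDegree ≤ n := by
  rcases eq_or_ne a 0 with rfl | ha
  · simp
  rw [mem_riemannRochSpace_smul_poles_iff hz (aeval_ne_zero_of_transcendental hz ha)]
  constructor
  · rintro ⟨-, h⟩
    obtain ⟨P, hP⟩ := exists_ord_neg hz
    have := h P hP
    rw [P.ord_aeval_of_neg hP ha, mul_le_mul_right_of_neg hP] at this
    exact_mod_cast this
  · refine fun h => ⟨fun P hP => P.ord_aeval_nonneg hP a, fun P hP => ?_⟩
    rw [P.ord_aeval_of_neg hP ha, mul_le_mul_right_of_neg hP]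
    exact_mod_cast h

end CurveDivisor

namespace HyperellipticModel

variable {k K : Type*} [Field k] [Field K] [Algebra k K] {g : ℕ} (M : HyperellipticModel k K g)

/-- The divisor of poles of `t`, that is, the points over `t = ∞`. -/
abbrev poles : CurveDivisor k K :=
  CurveDivisor.poles M.transcendental

theorem deg_poles : CurveDivisor.deg k K M.poles = 2 := by
  rw [CurveDivisor.deg_poles, M.finrank_eq_two, Nat.cast_ofNat]

theorem poles_nonneg : 0 ≤ M.poles := fun P => by
  rw [CurveDivisor.poles_apply]
  exact le_max_left _ _

theorem ord_aeval_poly (P : CurvePoint k K) : P.ord (aeval M.t M.poly) = 2 * P.ord M.u := by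
  rw [← M.u_sq, P.ord_pow, Nat.cast_ofNat]

theorem ord_u_of_neg {P : CurvePoint k K} (hP : P.ord M.t < 0) :
    P.ord M.u = (g + 1) * P.ord M.t := by
  have h := M.ord_aeval_poly P
  rw [P.ord_aeval_of_neg hP M.poly_ne_zero, M.natDegree_eq] at h
  push_cast at h
  linarith

theorem ord_u_nonneg {P : CurvePoint k K} (hP : 0 ≤ P.ord M.t) : 0 ≤ P.ord M.u := by
  have := M.ord_aeval_poly P ▸ P.ord_aeval_nonneg hP M.poly
  omega

theorem aeval_mul_u_mem_iff {b : k[X]} (hb : b ≠ 0) {n : ℕ} :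
    aeval M.t b * M.u ∈ CurveDivisor.riemannRochSpace (n • M.poles) ↔
      b.natDegree + (g + 1) ≤ n := by
  have hb0 := M.aeval_ne_zero hb
  have ord_eq {P : CurvePoint k K} (hP : P.ord M.t < 0) :
      P.ord (aeval M.t b * M.u) = (b.natDegree + (g + 1) : ℕ) * P.ord M.t := by
    rw [P.ord_mul hb0 M.u_ne_zero, P.ord_aeval_of_neg hP hb, M.ord_u_of_neg hP]
    push_cast
    ring
  rw [CurveDivisor.mem_riemannRochSpace_smul_poles_iff _ (mul_ne_zero hb0 M.u_ne_zero)]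
  constructor
  · rintro ⟨-, h⟩
    obtain ⟨P, hP⟩ := CurveDivisor.exists_ord_neg M.transcendental
    have := h P hP
    rw [ord_eq hP, mul_le_mul_right_of_neg hP] at this
    exact_mod_cast this
  · refine fun h => ⟨fun P hP => ?_, fun P hP => ?_⟩
    · rw [P.ord_mul hb0 M.u_ne_zero]
      exact add_nonneg (P.ord_aeval_nonneg hP b) (M.ord_u_nonneg hP)
    · rw [ord_eq hP, mul_le_mul_right_of_neg hP]
      exact_mod_cast h

theorem ord_map_nonneg {f : K} (hf : ∀ P : CurvePoint k K, 0 ≤ P.ord M.t → 0 ≤ P.ord f)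
    (P : CurvePoint k K) (hP : 0 ≤ P.ord M.t) : 0 ≤ P.ord (M.σ f) := by
  rw [← P.ord_comap]
  exact hf _ (by rwa [P.ord_comap, M.map_t])

/-- The trace `2 a / c` and the square `4 b² S / c²` of the anti-invariant part of
`f = (a + b u) / c` are regular away from `t = ∞`, so `c` divides `a` and `b`. -/
theorem exists_eq_aeval_add_aeval_mul_u {f : K}
    (hf : ∀ P : CurvePoint k K, 0 ≤ P.ord M.t → 0 ≤ P.ord f) :
    ∃ a b : k[X], f = aeval M.t a + aeval M.t b * M.u := by
  obtain ⟨a, b, c, hc, hfc⟩ := M.exists_eq f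
  have hc0 : c ≠ 0 := by
    rintro rfl
    exact hc (map_zero _)
  have hσ : M.σ f * aeval M.t c = aeval M.t a - aeval M.t b * M.u := by
    rw [← M.map_aeval_add_aeval_mul_u, ← hfc, map_mul, M.map_aeval]
  have hunit {n : ℕ} : IsUnit (C ((2 : k) ^ n)) :=
    isUnit_C.2 (M.two_ne_zero.isUnit.pow n)
  have ha : c ∣ a := by
    refine (hunit (n := 1)).dvd_mul_left.1 (CurveDivisor.dvd_of_mul_aeval_eq M.transcendental
      (f := f + M.σ f) hc0 (fun P hP => ?_) ?_)
    · rw [P.ord_nonneg_iff]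
      exact add_mem (P.ord_nonneg_iff.1 (hf P hP)) (P.ord_nonneg_iff.1 (M.ord_map_nonneg hf P hP))
    · simp only [map_mul, map_pow, map_ofNat]
      linear_combination hfc + hσ
  have hb : c ∣ b := by
    refine dvd_of_sq_dvd_sq_mul M.squarefree ((hunit (n := 2)).dvd_mul_left.1
      (CurveDivisor.dvd_of_mul_aeval_eq M.transcendental (f := (f - M.σ f) ^ 2)
        (pow_ne_zero 2 hc0) (fun P hP => ?_) ?_))
    · rw [P.ord_nonneg_iff]
      exact pow_mem (sub_mem (P.ord_nonneg_iff.1 (hf P hP))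
        (P.ord_nonneg_iff.1 (M.ord_map_nonneg hf P hP))) 2
    · simp only [map_mul, map_pow, map_ofNat, ← M.u_sq]
      linear_combination ((f - M.σ f) * aeval M.t c + 2 * aeval M.t b * M.u) * (hfc - hσ)
  obtain ⟨a, rfl⟩ := ha
  obtain ⟨b, rfl⟩ := hb
  refine ⟨a, b, mul_right_cancel₀ hc ?_⟩
  rw [hfc, map_mul, map_mul]
  ring

theorem map_mem_riemannRochSpace {f : K} {n : ℕ}
    (hf : f ∈ CurveDivisor.riemannRochSpace (n • M.poles)) :
    M.σ f ∈ CurveDivisor.riemannRochSpace (n • M.poles) := by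
  rcases eq_or_ne f 0 with rfl | hf0
  · rwa [map_zero]
  rw [CurveDivisor.mem_riemannRochSpace_smul_poles_iff _ hf0] at hf
  rw [CurveDivisor.mem_riemannRochSpace_smul_poles_iff _ ((map_ne_zero M.σ).2 hf0)]
  refine ⟨M.ord_map_nonneg hf.1, fun P hP => ?_⟩
  have := hf.2 (P.comap M.σ)
  rw [P.ord_comap, P.ord_comap, M.map_t] at this
  exact this hP

theorem exists_of_mem_riemannRochSpace {f : K} {n : ℕ}
    (hf : f ∈ CurveDivisor.riemannRochSpace (n • M.poles)) :
    ∃ a b : k[X], f = aeval M.t a + aeval M.t b * M.u ∧ a.natDegree ≤ n ∧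
      (b ≠ 0 → b.natDegree + (g + 1) ≤ n) := by
  rcases eq_or_ne f 0 with rfl | hf0
  · exact ⟨0, 0, by simp⟩
  obtain ⟨a, b, hab⟩ := M.exists_eq_aeval_add_aeval_mul_u
    ((CurveDivisor.mem_riemannRochSpace_smul_poles_iff _ hf0).1 hf).1
  have hσ : M.σ f = aeval M.t a - aeval M.t b * M.u := by
    rw [hab, M.map_aeval_add_aeval_mul_u]
  have ha : aeval M.t a = (2 : k)⁻¹ • (f + M.σ f) := by
    rw [hσ, hab, eq_inv_smul_iff₀ M.two_ne_zero, ofNat_smul_eq_nsmul]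
    ring
  have hb : aeval M.t b * M.u = (2 : k)⁻¹ • (f - M.σ f) := by
    rw [hσ, hab, eq_inv_smul_iff₀ M.two_ne_zero, ofNat_smul_eq_nsmul]
    ring
  have hσf := M.map_mem_riemannRochSpace hf
  refine ⟨a, b, hab,
    (CurveDivisor.aeval_mem_riemannRochSpace_smul_poles_iff M.transcendental).1 ?_,
    fun hb0 => (M.aeval_mul_u_mem_iff hb0).1 ?_⟩
  · exact ha ▸ Submodule.smul_mem _ _ (add_mem hf hσf)
  · exact hb ▸ Submodule.smul_mem _ _ (sub_mem hf hσf)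

theorem exists_eq_aeval_of_mem_riemannRochSpace {f : K} {n : ℕ} (hn : n ≤ g)
    (hf : f ∈ CurveDivisor.riemannRochSpace (n • M.poles)) :
    ∃ a : k[X], f = aeval M.t a ∧ a.natDegree ≤ n := by
  obtain ⟨a, b, hab, ha, hb⟩ := M.exists_of_mem_riemannRochSpace hf
  obtain rfl : b = 0 := by
    by_contra hb0
    have := hb hb0
    omega
  exact ⟨a, by rw [hab, map_zero, zero_mul, add_zero], ha⟩

include M in
theorem exists_eq_algebraMap_mul {D : CurveDivisor k K} {f h : K} (hf : D.IsDivisorOf f)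
    (hh : D.IsDivisorOf h) : ∃ c : k, c ≠ 0 ∧ f = algebraMap k K c * h := by
  have hmem : f / h ∈ CurveDivisor.riemannRochSpace (0 • M.poles) := fun _ P => by
    rw [P.ord_div hf.1 hh.1, ← hf.2, ← hh.2, sub_self, zero_smul, Finsupp.zero_apply, neg_zero]
  obtain ⟨a, ha, hdeg⟩ := M.exists_eq_aeval_of_mem_riemannRochSpace (Nat.zero_le g) hmem
  rw [eq_C_of_natDegree_le_zero hdeg, aeval_C, div_eq_iff hh.1] at ha
  refine ⟨a.coeff 0, fun h0 => hf.1 ?_, ha⟩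
  rw [ha, h0, map_zero, zero_mul]

theorem norm_ne_zero {a b : k[X]} (h : aeval M.t a + aeval M.t b * M.u ≠ 0) :
    a ^ 2 - b ^ 2 * M.poly ≠ 0 := fun h0 =>
  mul_ne_zero h ((map_ne_zero M.σ).2 h)
    (by rw [M.mul_map_aeval_add_aeval_mul_u, h0, map_zero])

theorem ord_aeval_add_aeval_mul_u_nonneg {P : CurvePoint k K} (hP : 0 ≤ P.ord M.t) (a b : k[X]) :
    0 ≤ P.ord (aeval M.t a + aeval M.t b * M.u) :=
  P.ord_nonneg_iff.2 (add_mem (P.ord_nonneg_iff.1 (P.ord_aeval_nonneg hP a))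
    (mul_mem (P.ord_nonneg_iff.1 (P.ord_aeval_nonneg hP b))
      (P.ord_nonneg_iff.1 (M.ord_u_nonneg hP))))

theorem ord_add_ord_map (P : CurvePoint k K) {a b : k[X]}
    (h : aeval M.t a + aeval M.t b * M.u ≠ 0) :
    P.ord (aeval M.t a + aeval M.t b * M.u) + P.ord (M.σ (aeval M.t a + aeval M.t b * M.u)) =
      P.ord (aeval M.t (a ^ 2 - b ^ 2 * M.poly)) := by
  rw [← P.ord_mul h ((map_ne_zero M.σ).2 h), M.mul_map_aeval_add_aeval_mul_u]

theorem exists_isDivisorOf_aeval_add_aeval_mul_u {a b : k[X]}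
    (h : aeval M.t a + aeval M.t b * M.u ≠ 0) :
    ∃ D : CurveDivisor k K, D.IsDivisorOf (aeval M.t a + aeval M.t b * M.u) ∧
      CurveDivisor.deg k K D = 0 := by
  classical
  obtain ⟨N, hN, hdegN⟩ :=
    CurveDivisor.exists_isDivisorOf_aeval M.transcendental (M.norm_ne_zero h)
  set f := aeval M.t a + aeval M.t b * M.u
  have hsupp (P : CurvePoint k K) (hP : P.ord f ≠ 0) : P ∈ M.poles.support ∪ N.support := by
    rw [Finset.mem_union, Finsupp.mem_support_iff, Finsupp.mem_support_iff, hN.2]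
    rcases lt_or_ge (P.ord M.t) 0 with hPt | hPt
    · refine .inl ?_
      rw [CurveDivisor.poles_of_neg _ hPt]
      omega
    · have hf : 0 ≤ P.ord f := M.ord_aeval_add_aeval_mul_u_nonneg hPt a b
      have hσf : 0 ≤ P.ord (M.σ f) :=
        M.ord_map_nonneg (fun Q hQ => M.ord_aeval_add_aeval_mul_u_nonneg hQ a b) P hPt
      have hsum : P.ord f + P.ord (M.σ f) = _ := M.ord_add_ord_map P h
      exact .inr (by omega)
  let D : CurveDivisor k K := Finsupp.onFinset _ (fun P => P.ord f) hsupp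
  have hD : D.IsDivisorOf f := ⟨h, fun P => rfl⟩
  obtain ⟨E, hE, hdegE⟩ := hD.exists_map M.σ
  refine ⟨D, hD, ?_⟩
  have hDE := (M.mul_map_aeval_add_aeval_mul_u a b ▸ hD.mul hE).eq hN
  have hdeg := congrArg (CurveDivisor.deg k K) hDE
  rw [map_add, hdegE, hdegN] at hdeg
  omega

include M in
theorem exists_isDivisorOf {f : K} (hf : f ≠ 0) :
    ∃ D : CurveDivisor k K, D.IsDivisorOf f ∧ CurveDivisor.deg k K D = 0 := by
  obtain ⟨a, b, c, hc, hfc⟩ := M.exists_eq f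
  have hc0 : c ≠ 0 := by
    rintro rfl
    exact hc (map_zero _)
  obtain ⟨D, hD, hdegD⟩ :=
    M.exists_isDivisorOf_aeval_add_aeval_mul_u (a := a) (b := b) (hfc ▸ mul_ne_zero hf hc)
  obtain ⟨E, hE, hdegE⟩ := CurveDivisor.exists_isDivisorOf_aeval M.transcendental hc0
  rw [(eq_mul_inv_iff_mul_eq₀ hc).2 hfc]
  exact ⟨_, hD.mul hE.inv, by rw [map_add, map_neg, hdegD, hdegE, neg_zero, add_zero]⟩

/-- The functions `a(t) + b(t) u` with `deg a ≤ m + g` and `deg b < m`. -/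
theorem exists_le_riemannRochSpace (m : ℕ) : ∃ V : Submodule k K, FiniteDimensional k V ∧
    finrank k V = 2 * m + g + 1 ∧ V ≤ CurveDivisor.riemannRochSpace ((m + g) • M.poles) := by
  let Φ : (degreeLT k (m + g + 1) × degreeLT k m) →ₗ[k] K :=
    LinearMap.coprod ((aeval M.t).toLinearMap ∘ₗ (degreeLT k (m + g + 1)).subtype)
      (LinearMap.mulRight k M.u ∘ₗ (aeval M.t).toLinearMap ∘ₗ (degreeLT k m).subtype)
  have hinj : Function.Injective Φ := by
    rw [injective_iff_map_eq_zero]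
    rintro ⟨a, b⟩ h
    obtain ⟨ha, hb⟩ := M.eq_zero_of_aeval_add_aeval_mul_u_eq_zero h
    exact Prod.ext (Subtype.ext ha) (Subtype.ext hb)
  have (n : ℕ) : FiniteDimensional k (degreeLT k n) := (degreeLTEquiv k n).symm.finiteDimensional
  have finrank_degreeLT (n : ℕ) : finrank k (degreeLT k n) = n := by
    rw [(degreeLTEquiv k n).finrank_eq, finrank_fin_fun]
  refine ⟨LinearMap.range Φ, inferInstance, ?_, ?_⟩
  · rw [LinearMap.finrank_range_of_inj hinj, finrank_prod, finrank_degreeLT, finrank_degreeLT]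
    ring
  · rintro _ ⟨⟨⟨a, ha⟩, ⟨b, hb⟩⟩, rfl⟩
    refine add_mem
      ((CurveDivisor.aeval_mem_riemannRochSpace_smul_poles_iff M.transcendental).2 ?_) ?_
    · rw [mem_degreeLT, degree_lt_iff_coeff_zero] at ha
      exact natDegree_le_iff_coeff_eq_zero.2 fun i hi => ha i hi
    · change aeval M.t b * M.u ∈ _
      rcases eq_or_ne b 0 with rfl | hb0
      · simp
      · rw [mem_degreeLT, ← natDegree_lt_iff_degree_lt hb0] at hb
        exact (M.aeval_mul_u_mem_iff hb0).2 (by omega)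

theorem exists_le_smul_poles {D : CurveDivisor k K}
    (hD : ∀ P : CurvePoint k K, 0 ≤ P.ord M.t → D P ≤ 0) : ∃ m : ℕ, D ≤ m • M.poles := by
  refine ⟨D.support.sup fun P => (D P).natAbs, fun P => ?_⟩
  rw [Finsupp.smul_apply, nsmul_eq_mul]
  rcases lt_or_ge (P.ord M.t) 0 with hP | hP
  · by_cases hPD : P ∈ D.support
    · have hle : (D P).natAbs ≤ _ := Finset.le_sup (f := fun P => (D P).natAbs) hPD
      rw [CurveDivisor.poles_of_neg _ hP]
      exact (by omega : D P ≤ _).trans (le_mul_of_one_le_right (Int.natCast_nonneg _) (by omega))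
    · rw [Finsupp.notMem_support_iff.1 hPD, CurveDivisor.poles_of_neg _ hP]
      exact mul_nonneg (Int.natCast_nonneg _) (by omega)
  · rw [CurveDivisor.poles_of_nonneg _ hP, mul_zero]
    exact hD P hP

include M in
theorem exists_mem_riemannRochSpace_of_le_deg {D : CurveDivisor k K}
    (hD : g ≤ CurveDivisor.deg k K D) : ∃ f ≠ 0, f ∈ CurveDivisor.riemannRochSpace D := by
  obtain ⟨p, hp, hDp⟩ := CurvePoint.exists_le_ord_aeval M.transcendental D
  obtain ⟨Z, hZ, hdegZ⟩ := CurveDivisor.exists_isDivisorOf_aeval M.transcendental hp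
  obtain ⟨m, hm⟩ := M.exists_le_smul_poles (D := D - Z) fun P hP => by
    rw [Finsupp.sub_apply, hZ.2]
    exact sub_nonpos.2 (hDp P hP)
  obtain ⟨V, _, hV, hVm⟩ := M.exists_le_riemannRochSpace m
  have hrank := CurveDivisor.finrank_inf_riemannRochSpace_le V
    (fun P => CurvePoint.degree_pos M.transcendental P)
    (hm.trans (nsmul_le_nsmul_left M.poles_nonneg (Nat.le_add_right m g)))
  rw [inf_eq_left.2 hVm, hV, map_sub, map_sub, map_nsmul, M.deg_poles, hdegZ, nsmul_eq_mul]
    at hrank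
  push_cast at hrank
  have : Nontrivial ↥(V ⊓ CurveDivisor.riemannRochSpace (D - Z)) :=
    nontrivial_of_finrank_pos (R := k) (by omega)
  obtain ⟨⟨f, hf⟩, hf0⟩ := exists_ne (0 : ↥(V ⊓ CurveDivisor.riemannRochSpace (D - Z)))
  have hmem := CurveDivisor.mul_mem_riemannRochSpace_sub hZ.inv hf.2
  rw [sub_neg_eq_add, sub_add_cancel] at hmem
  exact ⟨_, mul_ne_zero (fun h => hf0 (Subtype.ext h)) hZ.inv.1, hmem⟩

end HyperellipticModel

/-! ### Minimal polynomials -/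

namespace CurveDivisor

variable {k K : Type*} [Field k] [Field K] [Algebra k K] {D : CurveDivisor k K} {f : K} {n : ℕ}

theorem exists_nsmul_eq (h : ∀ P, (n : ℤ) ∣ D P) : ∃ E : CurveDivisor k K, n • E = D := by
  refine ⟨D.mapRange (· / (n : ℤ)) (Int.zero_ediv _), Finsupp.ext fun P => ?_⟩
  rw [Finsupp.smul_apply, Finsupp.mapRange_apply, nsmul_eq_mul]
  exact Int.mul_ediv_cancel' (h P)

theorem IsDivisorOf.dvd_ord (hD : (n • D).IsDivisorOf f) (P : CurvePoint k K) :
    (n : ℤ) ∣ P.ord f :=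
  ⟨D P, by rw [← hD.2, Finsupp.smul_apply, nsmul_eq_mul]⟩

end CurveDivisor

namespace HyperellipticModel

variable {k K : Type*} [Field k] [Field K] [Algebra k K] {g : ℕ} (M : HyperellipticModel k K g)

/-- The function `y(t) - u`. -/
def polySubU (y : k[X]) : K := aeval M.t y - M.u

/-- The polynomials `y` of degree at most `g + 1` for which `y² - S` is a nonzero constant times a
cube; for `g = 2` these are the minimal polynomials of the theorem. -/
def IsMinimal (y : k[X]) : Prop :=
  y.natDegree ≤ g + 1 ∧ ∃ (α : k) (x : k[X]), α ≠ 0 ∧ y ^ 2 - M.poly = C α * x ^ 3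

variable {M} {x y y₁ y₂ : k[X]} {D D₁ D₂ : CurveDivisor k K}

theorem polySubU_eq : M.polySubU y = aeval M.t y + aeval M.t (-1 : k[X]) * M.u := by
  rw [polySubU, map_neg, map_one, neg_one_mul, sub_eq_add_neg]

theorem map_polySubU : M.σ (M.polySubU y) = aeval M.t y + M.u := by
  rw [polySubU, map_sub, M.map_aeval, M.map_u, sub_neg_eq_add]

theorem polySubU_ne_zero : M.polySubU y ≠ 0 := fun h =>
  neg_ne_zero.2 (one_ne_zero (α := k[X]))
    (M.eq_zero_of_aeval_add_aeval_mul_u_eq_zero (polySubU_eq.symm.trans h)).2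

theorem polySubU_mul_map : M.polySubU y * M.σ (M.polySubU y) = aeval M.t (y ^ 2 - M.poly) := by
  rw [map_polySubU, polySubU, map_sub, map_pow, ← M.u_sq]
  ring

theorem ord_polySubU_add_ord_map (P : CurvePoint k K) :
    P.ord (M.polySubU y) + P.ord (M.σ (M.polySubU y)) = P.ord (aeval M.t (y ^ 2 - M.poly)) := by
  rw [← P.ord_mul polySubU_ne_zero ((map_ne_zero M.σ).2 polySubU_ne_zero), polySubU_mul_map]

theorem sq_sub_poly_ne_zero : y ^ 2 - M.poly ≠ 0 := by
  have := M.norm_ne_zero (polySubU_eq.symm.trans_ne (polySubU_ne_zero (y := y)))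
  rwa [neg_one_sq, one_mul] at this

theorem polySubU_mem_riemannRochSpace (hy : y.natDegree ≤ g + 1) :
    M.polySubU y ∈ CurveDivisor.riemannRochSpace ((g + 1) • M.poles) := by
  rw [polySubU_eq]
  refine add_mem
    ((CurveDivisor.aeval_mem_riemannRochSpace_smul_poles_iff M.transcendental).2 hy)
    ((M.aeval_mul_u_mem_iff (neg_ne_zero.2 one_ne_zero)).2 ?_)
  rw [natDegree_neg, natDegree_one, zero_add]

theorem le_ord_u_of_le_ord_polySubU {P : CurvePoint k K} {n : ℤ} (h : n ≤ P.ord (M.polySubU y))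
    (h' : n ≤ P.ord (M.σ (M.polySubU y))) : n ≤ P.ord M.u := by
  have hu : M.σ (M.polySubU y) - M.polySubU y = algebraMap k K 2 * M.u := by
    rw [map_polySubU, polySubU, map_ofNat]
    ring
  have h2 : algebraMap k K 2 ≠ 0 := (_root_.map_ne_zero _).2 M.two_ne_zero
  have := P.le_ord_sub (hu ▸ mul_ne_zero h2 M.u_ne_zero) (fun _ => h') fun _ => h
  rwa [hu, P.ord_mul h2 M.u_ne_zero, P.ord_algebraMap, zero_add] at this

theorem isCoprime_poly_of_sq_sub_eq {α : k} (h : y ^ 2 - M.poly = C α * x ^ 3) :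
    IsCoprime x M.poly := by
  refine isCoprime_of_irreducible_dvd (fun h0 => M.poly_ne_zero h0.2) fun π hπ hx hS => ?_
  have hx2 : π ^ 2 ∣ C α * x ^ 3 :=
    ((pow_dvd_pow_of_dvd hx 2).trans (pow_dvd_pow x (by norm_num))).mul_left _
  have hy : π ∣ y := by
    have := dvd_add ((dvd_pow_self π _root_.two_ne_zero).trans hx2) hS
    rw [← h, sub_add_cancel] at this
    exact hπ.prime.dvd_of_dvd_pow this
  have hS2 : π ^ 2 ∣ M.poly := by
    have := dvd_sub (pow_dvd_pow_of_dvd hy 2) hx2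
    rwa [← h, sub_sub_cancel] at this
  exact hπ.not_isUnit (M.squarefree π (by rwa [← sq]))

/-- The orders of `y(t) - u` and `y(t) + u` add up to a multiple of `3`. Away from `t = ∞` one of
them is `0`, since a common zero would be a zero of `x` and `u`; at a point over `t = ∞` one of
them is `(g + 1) ord t`, the order of their difference `2 u`. -/
theorem IsMinimal.three_dvd_ord (hy : M.IsMinimal y) (hg : 3 ∣ g + 1) (P : CurvePoint k K) :
    3 ∣ P.ord (M.polySubU y) := by
  obtain ⟨hdeg, α, x, hα, h⟩ := hy
  have hx : x ≠ 0 := by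
    rintro rfl
    exact M.sq_sub_poly_ne_zero (y := y) (by rw [h, zero_pow three_ne_zero, mul_zero])
  have hsum : P.ord (M.polySubU y) + P.ord (M.σ (M.polySubU y)) = 3 * P.ord (aeval M.t x) := by
    rw [ord_polySubU_add_ord_map, h, P.ord_aeval_mul M.transcendental (C_ne_zero.2 hα)
      (pow_ne_zero 3 hx), aeval_C, P.ord_algebraMap, map_pow, P.ord_pow, zero_add, Nat.cast_ofNat]
  have hmem := polySubU_mem_riemannRochSpace (M := M) hdeg
  have hmem' := M.map_mem_riemannRochSpace hmem
  rw [CurveDivisor.mem_riemannRochSpace_smul_poles_iff _ polySubU_ne_zero] at hmem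
  rw [CurveDivisor.mem_riemannRochSpace_smul_poles_iff _ ((map_ne_zero M.σ).2 polySubU_ne_zero)]
    at hmem'
  rcases lt_or_ge (P.ord M.t) 0 with hP | hP
  · have hle := hmem.2 P hP
    have hle' := hmem'.2 P hP
    have h3 : (3 : ℤ) ∣ (g + 1 : ℕ) * P.ord M.t := (Int.natCast_dvd_natCast.2 hg).mul_right _
    have hu : P.ord M.u = (g + 1 : ℕ) * P.ord M.t := by rw [M.ord_u_of_neg hP, Nat.cast_succ]
    by_cases heq : P.ord (M.polySubU y) = (g + 1 : ℕ) * P.ord M.t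
    · rwa [heq]
    · have := mt (M.le_ord_u_of_le_ord_polySubU (y := y) (P := P)
        (n := (g + 1 : ℕ) * P.ord M.t + 1) (by omega))
      omega
  · have hle := hmem.1 P hP
    have hle' := hmem'.1 P hP
    by_cases hx0 : 0 < P.ord (aeval M.t x)
    · have hu := M.ord_aeval_poly P ▸
        P.ord_aeval_eq_zero_of_isCoprime (isCoprime_poly_of_sq_sub_eq h) hx0
      have := mt (M.le_ord_u_of_le_ord_polySubU (y := y) (P := P) (n := 1))
      omega
    · omega

theorem IsMinimal.exists_isDivisorOf (hy : M.IsMinimal y) (hg : 3 ∣ g + 1) :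
    ∃ D : CurveDivisor k K, CurveDivisor.deg k K D = 0 ∧ (3 • D).IsDivisorOf (M.polySubU y) := by
  obtain ⟨E, hE, hdeg⟩ := M.exists_isDivisorOf (M.polySubU_ne_zero (y := y))
  obtain ⟨D, rfl⟩ := E.exists_nsmul_eq (n := 3) fun P => hE.2 P ▸ hy.three_dvd_ord hg P
  rw [map_nsmul] at hdeg
  exact ⟨D, (smul_eq_zero_iff_right three_ne_zero).1 hdeg, hE⟩

/-- If `D = div f` then `f³` is a constant times `y(t) - u`; hence `f` lies in
`L(g • poles)` and is a polynomial in `t`, which contradicts the presence of `u`. -/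
theorem notMem_principal_of_isDivisorOf_polySubU (hg : g ≠ 0) (hy : y.natDegree ≤ g + 1)
    (hD : (3 • D).IsDivisorOf (M.polySubU y)) : D ∉ CurveDivisor.principal k K := by
  rintro ⟨f, hf⟩
  obtain ⟨c, -, hc⟩ := M.exists_eq_algebraMap_mul (hf.pow 3) hD
  have hmem : f ∈ CurveDivisor.riemannRochSpace (g • M.poles) := by
    refine CurveDivisor.mem_riemannRochSpace_of_pow_mem (n := 3) three_pos
      (D := (g + 1) • M.poles) ?_ ?_
    · rw [hc, ← Algebra.smul_def]
      exact Submodule.smul_mem _ _ (polySubU_mem_riemannRochSpace hy)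
    · rw [smul_smul]
      exact nsmul_le_nsmul_left M.poles_nonneg (by omega)
  obtain ⟨a, ha, -⟩ := M.exists_eq_aeval_of_mem_riemannRochSpace le_rfl hmem
  have hc0 : c = 0 := by
    have := (M.eq_and_eq_of_aeval_add_aeval_mul_u_eq (a := a ^ 3) (b := 0) (a' := C c * y)
      (b' := -C c) (by
        rw [ha, polySubU] at hc
        simp only [map_mul, map_pow, map_neg, map_zero, aeval_C]
        linear_combination hc)).2
    exact C_eq_zero.1 (neg_eq_zero.1 this.symm)
  rw [hc0, map_zero, zero_mul] at hc
  exact hf.1 (pow_eq_zero_iff three_ne_zero |>.1 hc)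

/-- Let `D₁ - D₂ = div f` and `y₂² - S = α x³`. Then `(f x(t))³` is a constant times
`(y₁(t) - u) (y₂(t) + u)`, so `f x(t)` is a polynomial in `t`, and the coefficient `y₁ - y₂` of `u`
in this product vanishes. -/
theorem IsMinimal.eq_of_sub_mem_principal (hy₂ : M.IsMinimal y₂) (hg : 2 ≤ g)
    (hy₁ : y₁.natDegree ≤ g + 1) (hD₁ : (3 • D₁).IsDivisorOf (M.polySubU y₁))
    (hD₂ : (3 • D₂).IsDivisorOf (M.polySubU y₂))
    (h : D₁ - D₂ ∈ CurveDivisor.principal k K) : y₁ = y₂ := by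
  obtain ⟨f, hf⟩ := h
  obtain ⟨hdeg, α, x, hα, hx⟩ := hy₂
  have hD : (3 • D₁).IsDivisorOf (f ^ 3 * M.polySubU y₂) := by
    have := (hf.pow 3).mul hD₂
    rwa [smul_sub, sub_add_cancel] at this
  obtain ⟨c, hc0, hc⟩ := M.exists_eq_algebraMap_mul hD hD₁
  have hcube : algebraMap k K α * (f * aeval M.t x) ^ 3 =
      algebraMap k K c * (M.polySubU y₁ * M.σ (M.polySubU y₂)) := by
    have hN := M.polySubU_mul_map (y := y₂)
    rw [hx, map_mul, aeval_C, map_pow] at hN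
    linear_combination M.σ (M.polySubU y₂) * hc - f ^ 3 * hN
  have hmem : f * aeval M.t x ∈ CurveDivisor.riemannRochSpace (g • M.poles) := by
    refine CurveDivisor.mem_riemannRochSpace_of_pow_mem (n := 3) three_pos
      (D := (g + 1) • M.poles + (g + 1) • M.poles) ?_ ?_
    · rw [← Submodule.smul_mem_iff _ hα, Algebra.smul_def, hcube, ← Algebra.smul_def]
      exact Submodule.smul_mem _ _ (CurveDivisor.mul_mem_riemannRochSpace_add
        (polySubU_mem_riemannRochSpace hy₁)
        (M.map_mem_riemannRochSpace (polySubU_mem_riemannRochSpace hdeg)))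
    · rw [← add_smul, smul_smul]
      exact nsmul_le_nsmul_left M.poles_nonneg (by omega)
  obtain ⟨a, ha, -⟩ := M.exists_eq_aeval_of_mem_riemannRochSpace le_rfl hmem
  have hu := (M.eq_and_eq_of_aeval_add_aeval_mul_u_eq (a := C α * a ^ 3) (b := 0)
    (a' := C c * (y₁ * y₂ - M.poly)) (b' := C c * (y₁ - y₂)) (by
      rw [ha, map_polySubU, polySubU] at hcube
      simp only [map_mul, map_pow, map_sub, map_zero, aeval_C, ← M.u_sq]
      linear_combination hcube)).2
  exact sub_eq_zero.1 ((mul_eq_zero.1 hu.symm).resolve_left (C_ne_zero.2 hc0))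

theorem coprime_three_finrank : Nat.Coprime 3 (finrank k⟮M.t⟯ K) := by
  rw [M.finrank_eq_two]
  norm_num

theorem isMinimal_of_isDivisorOf_polySubU (hy : y.natDegree ≤ g + 1)
    (hD : (3 • D).IsDivisorOf (M.polySubU y)) : M.IsMinimal y := by
  refine ⟨hy, CurvePoint.exists_eq_C_mul_pow M.transcendental coprime_three_finrank
    sq_sub_poly_ne_zero fun P _ => ?_⟩
  rw [← ord_polySubU_add_ord_map, ← P.ord_comap]
  exact dvd_add (hD.dvd_ord P) (hD.dvd_ord _)

end HyperellipticModel

namespace HyperellipticModel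

variable {k K : Type*} [Field k] [Field K] [Algebra k K] {M : HyperellipticModel k K 2}
  {D : CurveDivisor k K} {f : K}

/-- The function `f` is `a(t) + β u` with `β` constant. The case `β = 0` would make `D` the
divisor of a polynomial in `t`, because `[K : k(t)] = 2` is prime to `3`. -/
theorem exists_isDivisorOf_polySubU (hD : D ∉ CurveDivisor.principal k K) (hDp : -M.poles ≤ D)
    (hf : (3 • D).IsDivisorOf f) :
    ∃ y : k[X], y.natDegree ≤ 3 ∧ (3 • D).IsDivisorOf (M.polySubU y) := by
  have hmem : f ∈ CurveDivisor.riemannRochSpace (3 • M.poles) := fun _ P => by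
    rw [← hf.2, ← Finsupp.neg_apply, ← smul_neg]
    exact nsmul_le_nsmul_right hDp 3 P
  obtain ⟨a, b, hab, ha, hb⟩ := M.exists_of_mem_riemannRochSpace hmem
  have hb0 : b ≠ 0 := by
    rintro rfl
    rw [map_zero, zero_mul, add_zero] at hab
    exact hD (CurveDivisor.mem_principal_of_nsmul_isDivisorOf_aeval M.transcendental three_ne_zero
      coprime_three_finrank (hab ▸ hf))
  obtain ⟨β, rfl⟩ : ∃ β, b = C β := ⟨_, eq_C_of_natDegree_le_zero (by have := hb hb0; omega)⟩
  have hβ : -β⁻¹ ≠ 0 := neg_ne_zero.2 (inv_ne_zero (C_ne_zero.1 hb0))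
  refine ⟨C (-β⁻¹) * a, (natDegree_C_mul_le _ _).trans ha, ?_⟩
  have hβ' : algebraMap k K β ≠ 0 := (_root_.map_ne_zero _).2 (C_ne_zero.1 hb0)
  convert hf.algebraMap_mul hβ using 1
  rw [hab, polySubU, map_mul, aeval_C, aeval_C, map_neg, map_inv₀]
  field_simp
  ring

/-- A nonzero section of `L(D₀ + poles)`, whose degree is the genus, moves `D₀` within its class
to a divisor `D ≥ -poles`. -/
theorem exists_isMinimal {D₀ : CurveDivisor k K} (hdeg : CurveDivisor.deg k K D₀ = 0)
    (hD₀ : D₀ ∉ CurveDivisor.principal k K) (h3 : 3 • D₀ ∈ CurveDivisor.principal k K) :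
    ∃ y, M.IsMinimal y ∧ ∃ D : CurveDivisor k K, CurveDivisor.deg k K D = 0 ∧
      (3 • D).IsDivisorOf (M.polySubU y) ∧ D - D₀ ∈ CurveDivisor.principal k K := by
  obtain ⟨h, hh⟩ := h3
  obtain ⟨s, hs0, hs⟩ := M.exists_mem_riemannRochSpace_of_le_deg (D := D₀ + M.poles) (by
    rw [map_add, hdeg, M.deg_poles, zero_add, Nat.cast_ofNat])
  obtain ⟨E, hE, hdegE⟩ := M.exists_isDivisorOf hs0
  have hEp : E ∈ CurveDivisor.principal k K := ⟨s, hE⟩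
  have hD : D₀ + E ∉ CurveDivisor.principal k K := fun h => hD₀ ((add_mem_cancel_right hEp).1 h)
  have hDp : -M.poles ≤ D₀ + E := fun P => by
    have := hs hs0 P
    rw [← hE.2, Finsupp.add_apply] at this
    rw [Finsupp.neg_apply, Finsupp.add_apply]
    omega
  have h3D : (3 • (D₀ + E)).IsDivisorOf (h * s ^ 3) := smul_add 3 D₀ E ▸ hh.mul (hE.pow 3)
  obtain ⟨y, hy, hyD⟩ := exists_isDivisorOf_polySubU hD hDp h3D
  refine ⟨y, isMinimal_of_isDivisorOf_polySubU hy hyD, D₀ + E, ?_, hyD, ?_⟩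
  · rw [map_add, hdeg, hdegE, add_zero]
  · rwa [add_sub_cancel_left]

end HyperellipticModel

/-! ### The curve `u² = S(t)` -/

namespace SeparableSextic

variable {k : Type*} [Field k] (S : SeparableSextic k)

theorem monic_equation : (X ^ 2 - C S.poly : k[X][X]).Monic :=
  monic_X_pow_sub_C _ two_ne_zero

theorem natDegree_equation : (X ^ 2 - C S.poly : k[X][X]).natDegree = 2 :=
  natDegree_X_pow_sub_C

theorem root_sq : (AdjoinRoot.root (X ^ 2 - C S.poly : k[X][X])) ^ 2 =
    AdjoinRoot.of (X ^ 2 - C S.poly) S.poly := by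
  have := AdjoinRoot.eval₂_root (X ^ 2 - C S.poly : k[X][X])
  rwa [eval₂_sub, eval₂_pow, eval₂_X, eval₂_C, sub_eq_zero] at this

theorem u_sq : S.u ^ 2 = S.ofPoly S.poly := by
  rw [u, ← map_pow, root_sq, ofPoly]

theorem ofPoly_injective : Function.Injective S.ofPoly := by
  refine (IsFractionRing.injective S.CoordinateRing S.FunctionField).comp
    (AdjoinRoot.of.injective_of_degree_ne_zero ?_)
  rw [degree_X_pow_sub_C two_pos]
  exact two_ne_zero

theorem exists_eq_of_add_of_mul_root (r : S.CoordinateRing) : ∃ a b : k[X],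
    r = AdjoinRoot.of _ a + AdjoinRoot.of _ b * AdjoinRoot.root _ := by
  obtain ⟨p, rfl⟩ := AdjoinRoot.mk_surjective r
  have hdeg := natDegree_modByMonic_lt p S.monic_equation
    (ne_of_apply_ne natDegree (by rw [natDegree_equation, natDegree_one]; exact two_ne_zero))
  rw [natDegree_equation] at hdeg
  obtain ⟨b, a, h⟩ := exists_eq_X_add_C_of_natDegree_le_one (Nat.le_of_lt_succ hdeg)
  refine ⟨a, b, ?_⟩
  rw [← AdjoinRoot.mk_leftInverse S.monic_equation (AdjoinRoot.mk _ p),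
    AdjoinRoot.modByMonicHom_mk, h, map_add, map_mul, AdjoinRoot.mk_C, AdjoinRoot.mk_C,
    AdjoinRoot.mk_X, add_comm]

theorem exists_ofPoly_eq (f : S.FunctionField) : ∃ a b c : k[X],
    S.ofPoly c ≠ 0 ∧ f * S.ofPoly c = S.ofPoly a + S.ofPoly b * S.u := by
  obtain ⟨r, s, hs, rfl⟩ := IsFractionRing.div_surjective (A := S.CoordinateRing) f
  have := S.monic_equation.finite_adjoinRoot
  obtain ⟨c, hc, w, hw⟩ :=
    (Algebra.IsAlgebraic.isAlgebraic (R := k[X]) s).exists_nonzero_dvd hs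
  obtain ⟨a, b, hab⟩ := S.exists_eq_of_add_of_mul_root (r * w)
  have hs0 : algebraMap S.CoordinateRing S.FunctionField s ≠ 0 :=
    IsFractionRing.to_map_ne_zero_of_mem_nonZeroDivisors hs
  refine ⟨a, b, c, ?_, ?_⟩
  · exact fun h0 => hc (S.ofPoly_injective (h0.trans (by rw [ofPoly, map_zero, map_zero])))
  · rw [ofPoly, ofPoly, ofPoly, u, ← map_mul, ← map_add, ← hab, ← AdjoinRoot.algebraMap_eq, hw,
      map_mul, map_mul]
    field_simp

/-- The hyperelliptic involution `u ↦ -u` on the coordinate ring, as a homomorphism. -/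
def involutionHom : S.CoordinateRing →ₐ[k] S.CoordinateRing :=
  AdjoinRoot.liftAlgHom _ (IsScalarTower.toAlgHom k k[X] S.CoordinateRing) (-AdjoinRoot.root _) (by
    rw [eval₂_sub, eval₂_pow, eval₂_X, eval₂_C, neg_sq, root_sq]
    exact sub_self _)

theorem involutionHom_of (a : k[X]) :
    S.involutionHom (AdjoinRoot.of _ a) = AdjoinRoot.of _ a :=
  AdjoinRoot.liftAlgHom_of ..

theorem involutionHom_root : S.involutionHom (AdjoinRoot.root _) = -AdjoinRoot.root _ :=
  AdjoinRoot.liftAlgHom_root ..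

theorem involutionHom_involutionHom (r : S.CoordinateRing) :
    S.involutionHom (S.involutionHom r) = r := by
  obtain ⟨a, b, rfl⟩ := S.exists_eq_of_add_of_mul_root r
  simp only [map_add, map_mul, map_neg, involutionHom_of, involutionHom_root, neg_neg]

/-- The hyperelliptic involution on the coordinate ring. -/
def involution : S.CoordinateRing ≃ₐ[k] S.CoordinateRing :=
  AlgEquiv.ofAlgHom S.involutionHom S.involutionHom
    (AlgHom.ext S.involutionHom_involutionHom) (AlgHom.ext S.involutionHom_involutionHom)

/-- The hyperelliptic involution on the function field. -/
def fieldInvolution : S.FunctionField ≃ₐ[k] S.FunctionField :=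
  IsFractionRing.fieldEquivOfAlgEquiv k S.FunctionField S.FunctionField S.involution

theorem ofPoly_eq_aeval (p : k[X]) : S.ofPoly p = aeval (S.ofPoly X) p := by
  rw [ofPoly, ofPoly, aeval_algebraMap_apply, ← AdjoinRoot.algebraMap_eq, aeval_algebraMap_apply,
    aeval_X_left_apply]

theorem transcendental_ofPoly_X : Transcendental k (S.ofPoly X) := by
  refine transcendental_iff.2 fun p hp => S.ofPoly_injective ?_
  rw [ofPoly_eq_aeval, hp, ofPoly_eq_aeval, map_zero]

/-- The function field of `u² = S(t)` as a hyperelliptic function field of genus `2`. -/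
def model (h2 : (2 : k) ≠ 0) : HyperellipticModel k S.FunctionField 2 where
  poly := S.poly
  t := S.ofPoly X
  u := S.u
  σ := S.fieldInvolution
  two_ne_zero := h2
  natDegree_eq := S.natDegree_eq
  squarefree := S.separable.squarefree
  u_sq := by rw [u_sq, ofPoly_eq_aeval]
  transcendental := S.transcendental_ofPoly_X
  exists_eq f := by
    simp only [← ofPoly_eq_aeval]
    exact S.exists_ofPoly_eq f
  map_t := (IsFractionRing.fieldEquivOfAlgEquiv_algebraMap ..).trans
    (congrArg _ (S.involutionHom_of X))
  map_u := by
    refine (IsFractionRing.fieldEquivOfAlgEquiv_algebraMap ..).trans ?_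
    rw [u, ← map_neg]
    exact congrArg _ S.involutionHom_root

theorem ofPoly_sub_u (h2 : (2 : k) ≠ 0) (y : k[X]) :
    S.ofPoly y - S.u = (S.model h2).polySubU y := by
  rw [ofPoly_eq_aeval]
  rfl

theorem isMinimal_model_iff (h2 : (2 : k) ≠ 0) {y : k[X]} :
    (S.model h2).IsMinimal y ↔ S.IsMinimal y :=
  Iff.rfl

end SeparableSextic

namespace CurveDivisor

variable {k K : Type*} [Field k] [Field K] [Algebra k K]

theorem mk_eq_mk_iff {D E : degZero k K} :
    (QuotientAddGroup.mk D : ClassGroupZero k K) = QuotientAddGroup.mk E ↔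
      (D - E : CurveDivisor k K) ∈ principal k K := by
  rw [eq_comm, QuotientAddGroup.eq, AddSubgroup.mem_addSubgroupOf, neg_add_eq_sub]
  rfl

theorem mk_eq_zero_iff {D : degZero k K} :
    (QuotientAddGroup.mk D : ClassGroupZero k K) = 0 ↔
      (D : CurveDivisor k K) ∈ principal k K := by
  rw [QuotientAddGroup.eq_zero_iff, AddSubgroup.mem_addSubgroupOf]

end CurveDivisor

end

theorem theorem1_general {k : Type*} [Field k] (h2 : (2 : k) ≠ 0) (S : SeparableSextic k) :
    (∀ y : Polynomial k, S.IsMinimal y →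
      ∃ D : CurveDivisor.degZero k S.FunctionField,
        (3 • (D : S.Divisor)).IsDivisorOf (S.ofPoly y - S.u) ∧
        (D : S.Divisor) ∉ CurveDivisor.principal k S.FunctionField) ∧
    (∀ T : S.Jacobian, T ≠ 0 → 3 • T = 0 →
      ∃! y : Polynomial k, S.IsMinimal y ∧
        ∃ D : CurveDivisor.degZero k S.FunctionField,
          (3 • (D : S.Divisor)).IsDivisorOf (S.ofPoly y - S.u) ∧
          (QuotientAddGroup.mk D : S.Jacobian) = T) := by
  simp only [S.ofPoly_sub_u h2, ← S.isMinimal_model_iff h2]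
  refine ⟨fun y hy => ?_, fun T hT hT3 => ?_⟩
  · obtain ⟨D, hdeg, hD⟩ := hy.exists_isDivisorOf (Nat.dvd_refl 3)
    exact ⟨⟨D, hdeg⟩, hD,
      HyperellipticModel.notMem_principal_of_isDivisorOf_polySubU two_ne_zero hy.1 hD⟩
  · obtain ⟨D₀, rfl⟩ := QuotientAddGroup.mk_surjective T
    rw [Ne, CurveDivisor.mk_eq_zero_iff] at hT
    rw [← QuotientAddGroup.mk_nsmul, CurveDivisor.mk_eq_zero_iff] at hT3
    obtain ⟨y, hy, D, hdeg, hD, hDD₀⟩ := HyperellipticModel.exists_isMinimal D₀.2 hT hT3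
    lift D to CurveDivisor.degZero k S.FunctionField using hdeg
    rw [← CurveDivisor.mk_eq_mk_iff] at hDD₀
    refine ⟨y, ⟨hy, D, hD, hDD₀⟩, ?_⟩
    rintro y' ⟨hy', D', hD', hD'T⟩
    exact hy.eq_of_sub_mem_principal le_rfl hy'.1 hD' hD
      (CurveDivisor.mk_eq_mk_iff.1 (hD'T.trans hDD₀.symm))

theorem theorem1 {k : Type*} [Field k] (h2 : (2 : k) ≠ 0) (h3 : (3 : k) ≠ 0)
    (hρ : ∃ ρ : k, IsPrimitiveRoot ρ 3) (S : SeparableSextic k) :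
    (∀ y : Polynomial k, S.IsMinimal y →
      ∃ D : CurveDivisor.degZero k S.FunctionField,
        (3 • (D : S.Divisor)).IsDivisorOf (S.ofPoly y - S.u) ∧
        (D : S.Divisor) ∉ CurveDivisor.principal k S.FunctionField) ∧
    (∀ T : S.Jacobian, T ≠ 0 → 3 • T = 0 →
      ∃! y : Polynomial k, S.IsMinimal y ∧
        ∃ D : CurveDivisor.degZero k S.FunctionField,
          (3 • (D : S.Divisor)).IsDivisorOf (S.ofPoly y - S.u) ∧
          (QuotientAddGroup.mk D : S.Jacobian) = T) :=
  theorem1_general h2 S
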